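/- Let $\ell>0$ and let $f\in W^{1,2}(0,\ell)$ be complex-valued (identified with its continuous representative on $[0,\ell]$), with $f(x)\neq 0$ for all $x\in[0,\ell]$ and $f(0)=1$. Let $q_f=f''/f$ denote the distribution $(q_f|\phi)=\int_0^\ell\{(f'/f)^2\phi-(f'/f)\phi'\}$ and let $\mathbf S_f y=-y''+q_f y$ (in the sense of distributions), that is $(\mathbf S_f y|\phi)=\int_0^\ell y'\phi'+(q_f|y\phi)$ for $y\in W^{1,2}(0,\ell)$, and $\mathbf L_f v=-\frac1{f^2}(f^2v')'$ for $v\in W^{2,2}(0,\ell)$. For $\rho\in\mathbb C$ let $e_f(\rho,\cdot)\in W^{1,2}(0,\ell)$ be the solution of $\mathbf S_f y=\rho^2y$ with $y(0)=1$, $\left(y'-\frac{f'}{f}y\right)(0)=i\rho$, and let $\widehat e_f(\rho,\cdot)\in W^{2,2}(0,\ell)$ be the solution of $\mathbf L_f v=\rho^2 v$ with $v(0)=1$, $v'(0)=i\rho$. Put $\mathcal T_\ell=\{(x,t):0\le x\le\ell,\ |t|\le x\}$. Then there exist kernels $K_f,\widehat K_f\in L^2(\mathcal T_\ell)$, with $K_f(x,\cdot)$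 and $\widehat K_f(x,\cdot)$ integrable on $(-x,x)$ for every $x\in(0,\ell]$, such that for all $\rho\in\mathbb C$ and $x\in(0,\ell]$ $$e_f(\rho,x)=e^{i\rho x}+\int_{-x}^xK_f(x,t)e^{i\rho t}\,dt,\qquad \widehat e_f(\rho,x)=e^{i\rho x}-i\rho\int_{-x}^x\widehat K_f(x,t)e^{i\rho t}\,dt .$$ Define $\mathbf T_fv(x)=v(x)+\int_{-x}^xK_f(x,t)v(t)\,dt$ and $\widehat{\mathbf T}_fv(x)=v(x)-\int_{-x}^x\widehat K_f(x,t)v'(t)\,dt$. For any such kernels the following hold. (i) $\widehat{\mathbf T}_fv=\frac1f\mathbf T_fv$ for every $v\in W^{1,2}(-\ell,\ell)$ (almost everywhere on $(0,\ell)$, and at every point of $[0,\ell]$ when $v$ is the continuous representative). (ii) For every $x\in(0,\ell]$, $\widehat K_f(x,\cdot)\in W^{1,2}(-x,x)$ with weak derivative $\frac1{f(x)}K_f(x,\cdot)$; thus $\frac{\partial\widehat K_f(x,t)}{\partial t}=\frac1{f(x)}K_f(x,t)$ a.e. in $\mathcal T_\ell$. (iii) For every $x\in(0,\ell]$ the continuous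 representative of $\widehat K_f(x,\cdot)$ on $[-x,x]$ satisfies $\widehat K_f(x,x)=1-\frac1{f(x)}$ and $\widehat K_f(x,-x)=0$. -/

import Mathlib

open MeasureTheory Set

noncomputable section

namespace Transmutation

/-- Complex-valued test functions: the space of smooth functions with compact support in the
open interval `(a, b)`. -/
def IsTest (a b : ℝ) (φ : ℝ → ℂ) : Prop :=
  ContDiff ℝ (⊤ : ℕ∞) φ ∧ HasCompactSupport φ ∧ tsupport φ ⊆ Ioo a b

/-- `u` belongs to `W^{1,2}(a,b)` and its weak (distributional) derivative is `u'`.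
The predicate only depends on the almost-everywhere classes of `u` and `u'`. -/
structure HasW12Deriv (a b : ℝ) (u u' : ℝ → ℂ) : Prop where
  memLp : MemLp u 2 (volume.restrict (Ioo a b))
  memLp_deriv : MemLp u' 2 (volume.restrict (Ioo a b))
  weak : ∀ φ : ℝ → ℂ, IsTest a b φ →
    ∫ x in Ioo a b, u x * deriv φ x = -∫ x in Ioo a b, u' x * φ x

/-- `c` is the continuous representative on `[a,b]` of the class of `u` on `(a,b)`. -/
def IsContinuousRep (a b : ℝ) (u c : ℝ → ℂ) : Prop :=
  ContinuousOn c (Icc a b) ∧ c =ᵐ[volume.restrict (Ioo a b)] u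

/-- The action on `ψ` (with weak derivative `ψ'`) of the distribution
`q_f = f''/f`, that is `(q_f | ψ) = ∫ (f'/f)² ψ - (f'/f) ψ'`. -/
def potentialPairing (ℓ : ℝ) (f f' : ℝ → ℂ) (ψ ψ' : ℝ → ℂ) : ℂ :=
  ∫ x in Ioo 0 ℓ, ((f' x / f x) ^ 2 * ψ x - (f' x / f x) * ψ' x)

/-- The action on `φ` of the distribution `S_f y = -y'' + q_f y`, that is
`(S_f y | φ) = ∫ y' φ' + (q_f | y φ)`. -/
def schrodingerPairing (ℓ : ℝ) (f f' y y' φ : ℝ → ℂ) : ℂ :=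
  (∫ x in Ioo 0 ℓ, y' x * deriv φ x) +
    potentialPairing ℓ f f' (fun x => y x * φ x) (fun x => y' x * φ x + y x * deriv φ x)

/-- `y = e_f(ρ, ·)`: the solution in `W^{1,2}(0,ℓ)` (given by its continuous representative) of
`S_f y = ρ² y` in the sense of distributions with `y(0) = 1` and `D_f y(0) = iρ`, where
`D_f y = y' - (f'/f) y`; the function `w` is the continuous representative of `D_f y`. -/
def IsSchrodingerExp (ℓ : ℝ) (f f' : ℝ → ℂ) (ρ : ℂ) (y : ℝ → ℂ) : Prop :=
  ∃ y' w : ℝ → ℂ,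
    ContinuousOn y (Icc 0 ℓ) ∧ HasW12Deriv 0 ℓ y y' ∧
    (∀ φ : ℝ → ℂ, IsTest 0 ℓ φ →
      schrodingerPairing ℓ f f' y y' φ = ∫ x in Ioo 0 ℓ, ρ ^ 2 * y x * φ x) ∧
    IsContinuousRep 0 ℓ (fun x => y' x - f' x / f x * y x) w ∧
    y 0 = 1 ∧ w 0 = Complex.I * ρ

/-- The impedance exponential: the solution `v` in `W^{2,2}(0,ℓ)` of
`-(1/f²) (f² v')' = ρ² v` with `v(0) = 1` and `v'(0) = iρ`. -/
def IsImpedanceExp (ℓ : ℝ) (f : ℝ → ℂ) (ρ : ℂ) (v : ℝ → ℂ) : Prop :=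
  ∃ v' v'' : ℝ → ℂ,
    ContinuousOn v (Icc 0 ℓ) ∧ ContinuousOn v' (Icc 0 ℓ) ∧
    HasW12Deriv 0 ℓ v v' ∧ HasW12Deriv 0 ℓ v' v'' ∧
    HasW12Deriv 0 ℓ (fun x => f x ^ 2 * v' x) (fun x => -(f x ^ 2 * (ρ ^ 2 * v x))) ∧
    v 0 = 1 ∧ v' 0 = Complex.I * ρ

/-- The triangle `0 ≤ x ≤ ℓ`, `|t| ≤ x`. -/
def triangle (ℓ : ℝ) : Set (ℝ × ℝ) :=
  {p | 0 ≤ p.1 ∧ p.1 ≤ ℓ ∧ |p.2| ≤ p.1}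

/-- `K` belongs to `L²` of the triangle, and `K(x,·)` is integrable on `(-x,x)` for every `x`,
so that the integrals of `K(x,t) e^{iρt}` over `(-x,x)` are meaningful for every `x`. -/
def IsTriangleKernel (ℓ : ℝ) (K : ℝ → ℝ → ℂ) : Prop :=
  MemLp (Function.uncurry K) 2 (volume.restrict (triangle ℓ)) ∧
    ∀ x ∈ Ioc 0 ℓ, IntervalIntegrable (K x) volume (-x) x

/-- `K = K_f`: the transmutation kernel of the Schrodinger operator, determined by
`e_f(ρ,x) = e^{iρx} + ∫_{-x}^{x} K(x,t) e^{iρt} dt`. -/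
def IsSchrodingerKernel (ℓ : ℝ) (f f' : ℝ → ℂ) (K : ℝ → ℝ → ℂ) : Prop :=
  IsTriangleKernel ℓ K ∧
    ∀ ρ : ℂ, ∃ e : ℝ → ℂ, IsSchrodingerExp ℓ f f' ρ e ∧
      ∀ x ∈ Ioc 0 ℓ, e x = Complex.exp (Complex.I * ρ * x) +
        ∫ t in (-x)..x, K x t * Complex.exp (Complex.I * ρ * t)

/-- `Kh`: the transmutation kernel of the impedance operator, determined by
`ê_f(ρ,x) = e^{iρx} - iρ ∫_{-x}^{x} Kh(x,t) e^{iρt} dt`. -/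
def IsImpedanceKernel (ℓ : ℝ) (f : ℝ → ℂ) (Kh : ℝ → ℝ → ℂ) : Prop :=
  IsTriangleKernel ℓ Kh ∧
    ∀ ρ : ℂ, ∃ e : ℝ → ℂ, IsImpedanceExp ℓ f ρ e ∧
      ∀ x ∈ Ioc 0 ℓ, e x = Complex.exp (Complex.I * ρ * x) -
        Complex.I * ρ * ∫ t in (-x)..x, Kh x t * Complex.exp (Complex.I * ρ * t)

/-- The operator `T_f v (x) = v(x) + ∫_{-x}^{x} K(x,t) v(t) dt`. -/
def schrodingerOp (K : ℝ → ℝ → ℂ) (v : ℝ → ℂ) (x : ℝ) : ℂ :=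
  v x + ∫ t in (-x)..x, K x t * v t

/-- The operator `v ↦ v(x) - ∫_{-x}^{x} Kh(x,t) v'(t) dt`, where `v'` is the weak derivative
of `v`. -/
def impedanceOp (Kh : ℝ → ℝ → ℂ) (v v' : ℝ → ℂ) (x : ℝ) : ℂ :=
  v x - ∫ t in (-x)..x, Kh x t * v' t

end Transmutation

end

open MeasureTheory Set

noncomputable section

namespace Transmutation

/-! The link between the two problems is the identity `e_f = f · ê_f` (`IsSchrodingerExp.eq_mul`).
With `σ = f'/f` and `w = y' - σ y`, the Schrödinger equation is the system `y' = σ y + w`, `w' = -σ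
w - ρ² y`. Putting `v = y / f` and `W = f w` cancels every `σ` and leaves `v' = W / f²`, `W' = -ρ²
f² v`, which is the impedance equation. Its coefficients are continuous, so Gronwall gives
uniqueness. The passage between weak formulations and these systems rests on the lemma of du
Bois-Reymond.

Fix `x` and let `H` be the primitive of `K(x,·) / f(x)` that vanishes at `-x`. At `ρ = 0` the
Schrödinger solution is `f`, so `1 + ∫ K(x,t) dt = f(x)` and `H(x) = 1 - 1/f(x)`. Integration by
parts then shows that `H` represents `ê_f(ρ,x)` exactly as `Kh(x,·)` does, and injectivity of the
Fourier transform forces `H = Kh(x,·)` almost everywhere (`exists_primitive_ae_eq`). The regularity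
of the slices and the Goursat values are read off from `H`; the relation between the operators is
one more integration by parts, against `v`.

For existence, write `y = A + B` and `w = iρ(A - B)`. Then `A' = iρA + σB` and `B' = -iρB + σA`, and
Duhamel's formula expresses each component as an integral of `σ` times the other. Undoing the
exponential transform turns these formulas into Volterra equations along characteristics, `α = V₋(k₁
+ β)` and `β = V₊ α`, where `k₁(x,t) = σ((x+t)/2)/2`. The function `k₁` is only `L²`, but `V₋ k₁` is
bounded by Cauchy–Schwarz, and in a weighted sup norm `V₊` and `V₋` have norm at most `1/2`; a
Neumann series gives `α` and `β` (`exists_kernel_pair`). The kernel is `α + k₁ + β`, and its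
primitive divided by `f` is an impedance kernel. -/

/-! ### Primitives of integrable functions -/

/-- `u` is on `[a, b]` a primitive of the integrable function `u'`. -/
structure IsPrimitiveOn (a b : ℝ) (u u' : ℝ → ℂ) : Prop where
  integrable : IntervalIntegrable u' volume a b
  eq_add_integral : ∀ x ∈ Icc a b, u x = u a + ∫ t in a..x, u' t

/-- The sums in the definition for `g` are at most `C` times those for `h`. This carries absolute
continuity from `∫ ‖u‖` to the complex integral `∫ u`, and from `u` to `u⁻¹`. -/
theorem absolutelyContinuousOnInterval_of_dist_le {X Y : Type*} [PseudoMetricSpace X]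
    [PseudoMetricSpace Y] {g : ℝ → X} {h : ℝ → Y} {a b C : ℝ}
    (hh : AbsolutelyContinuousOnInterval h a b)
    (hgh : ∀ x ∈ uIcc a b, ∀ y ∈ uIcc a b, dist (g x) (g y) ≤ C * dist (h x) (h y)) :
    AbsolutelyContinuousOnInterval g a b := by
  have h0 := Filter.Tendsto.const_mul C (show Filter.Tendsto _ _ (nhds 0) from hh)
  rw [mul_zero] at h0
  refine squeeze_zero' ?_ ?_ h0
  · filter_upwards with E
    exact Finset.sum_nonneg fun _ _ => dist_nonneg
  · have : ∀ᶠ E : ℕ × (ℕ → ℝ × ℝ) in AbsolutelyContinuousOnInterval.totalLengthFilter ⊓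
        Filter.principal (AbsolutelyContinuousOnInterval.disjWithin a b),
        E ∈ AbsolutelyContinuousOnInterval.disjWithin a b :=
      Filter.eventually_inf_principal.mpr (by simp)
    filter_upwards [this] with E hE
    rw [Finset.mul_sum]
    refine Finset.sum_le_sum fun i hi => ?_
    exact hgh _ (hE.1 i hi).1 _ (hE.1 i hi).2

theorem absolutelyContinuousOnInterval_integral {u : ℝ → ℂ} {a b : ℝ}
    (hu : IntervalIntegrable u volume a b) :
    AbsolutelyContinuousOnInterval (fun x => ∫ t in a..x, u t) a b := by
  refine absolutelyContinuousOnInterval_of_dist_le (C := 1)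
    (hu.norm.absolutelyContinuousOnInterval_intervalIntegral left_mem_uIcc) ?_
  intro x hx y hy
  have hi : ∀ z ∈ uIcc a b, IntervalIntegrable u volume a z := fun z hz =>
    hu.mono_set (uIcc_subset_uIcc left_mem_uIcc hz)
  rw [dist_eq_norm, Real.dist_eq, one_mul,
    intervalIntegral.integral_interval_sub_left (hi x hx) (hi y hy),
    intervalIntegral.integral_interval_sub_left (hi x hx).norm (hi y hy).norm]
  exact intervalIntegral.norm_integral_le_abs_integral_norm

namespace IsPrimitiveOn

variable {a b : ℝ} {u u' v v' : ℝ → ℂ}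

theorem mono_right (hu : IsPrimitiveOn a b u u') {c : ℝ} (hc : c ∈ Icc a b) :
    IsPrimitiveOn a c u u' :=
  ⟨hu.integrable.mono_set (uIcc_subset_uIcc left_mem_uIcc (Icc_subset_uIcc hc)),
    fun x hx => hu.eq_add_integral x ⟨hx.1, hx.2.trans hc.2⟩⟩

theorem absolutelyContinuous (hab : a ≤ b) (hu : IsPrimitiveOn a b u u') :
    AbsolutelyContinuousOnInterval u a b := by
  refine absolutelyContinuousOnInterval_of_dist_le (C := 1)
    (absolutelyContinuousOnInterval_integral hu.integrable) ?_
  intro x hx y hy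
  rw [uIcc_of_le hab] at hx hy
  rw [hu.eq_add_integral x hx, hu.eq_add_integral y hy, one_mul, dist_add_left]

theorem continuousOn (hab : a ≤ b) (hu : IsPrimitiveOn a b u u') : ContinuousOn u (Icc a b) := by
  simpa [uIcc_of_le hab] using (hu.absolutelyContinuous hab).continuousOn

theorem ae_hasDerivAt (hu : IsPrimitiveOn a b u u') :
    ∀ᵐ x, x ∈ Ioo a b → HasDerivAt u (u' x) x := by
  filter_upwards [hu.integrable.ae_hasDerivAt_integral] with x hx hxab
  have h1 := (hx (Icc_subset_uIcc (Ioo_subset_Icc_self hxab)) a left_mem_uIcc).const_add (u a)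
  refine h1.congr_of_eventuallyEq ?_
  filter_upwards [Ioo_mem_nhds hxab.1 hxab.2] with y hy
  exact hu.eq_add_integral y (Ioo_subset_Icc_self hy)

/-- The difference from the integral of `u'` is absolutely continuous with derivative zero almost
everywhere, hence constant. -/
theorem of_absolutelyContinuous (hab : a ≤ b) (hu : AbsolutelyContinuousOnInterval u a b)
    (hu' : IntervalIntegrable u' volume a b)
    (hd : ∀ᵐ x, x ∈ Ioo a b → HasDerivAt u (u' x) x) : IsPrimitiveOn a b u u' := by
  refine ⟨hu', ?_⟩
  have hac := hu.sub (absolutelyContinuousOnInterval_integral hu')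
  obtain ⟨C, hC⟩ := hac.const_of_ae_hasDerivAt_zero (by
    have ha : ∀ᵐ x : ℝ, x ≠ a := by simp [ae_iff, measure_singleton]
    have hb : ∀ᵐ x : ℝ, x ≠ b := by simp [ae_iff, measure_singleton]
    filter_upwards [hd, hu'.ae_hasDerivAt_integral, ha, hb] with x h1 h2 h3 h4 hx
    have hx' := hx
    rw [uIcc_of_le hab] at hx'
    have h5 := (h1 ⟨lt_of_le_of_ne hx'.1 (Ne.symm h3), lt_of_le_of_ne hx'.2 h4⟩).sub
      (h2 hx a left_mem_uIcc)
    simpa using h5)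
  intro x hx
  have h1 := hC x (Icc_subset_uIcc hx)
  have h2 := hC a left_mem_uIcc
  simp only [Pi.sub_apply, intervalIntegral.integral_same, sub_zero] at h1 h2
  rw [h2, ← h1]
  ring

theorem of_hasDerivAt (hd : ∀ x, HasDerivAt u (u' x) x) (hc : Continuous u') :
    IsPrimitiveOn a b u u' := by
  refine ⟨hc.intervalIntegrable _ _, fun x hx => ?_⟩
  rw [intervalIntegral.integral_eq_sub_of_hasDerivAt (fun y _ => hd y) (hc.intervalIntegrable _ _)]
  ring

theorem congr_deriv (hab : a ≤ b) (hu : IsPrimitiveOn a b u u')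
    (h : ∀ᵐ x, x ∈ Ioo a b → u' x = v' x) : IsPrimitiveOn a b u v' := by
  have hb : ∀ᵐ x : ℝ, x ≠ b := by simp [ae_iff, measure_singleton]
  have h' : ∀ᵐ x, x ∈ Ioc a b → u' x = v' x := by
    filter_upwards [h, hb] with x h1 h2 hx
    exact h1 ⟨hx.1, lt_of_le_of_ne hx.2 h2⟩
  refine ⟨hu.integrable.congr_ae ?_, fun x hx => ?_⟩
  · rw [uIoc_of_le hab]
    exact (ae_restrict_iff' measurableSet_Ioc).2 h'
  · rw [hu.eq_add_integral x hx]
    congr 1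
    refine intervalIntegral.integral_congr_ae ?_
    filter_upwards [h'] with y h1 hy
    rw [uIoc_of_le hx.1] at hy
    exact h1 ⟨hy.1, hy.2.trans hx.2⟩

theorem congr (hab : a ≤ b) (hu : IsPrimitiveOn a b u u') (h : EqOn u v (Icc a b)) :
    IsPrimitiveOn a b v u' :=
  ⟨hu.integrable, fun x hx => by
    rw [← h hx, ← h (left_mem_Icc.2 hab), hu.eq_add_integral x hx]⟩

theorem add (hu : IsPrimitiveOn a b u u') (hv : IsPrimitiveOn a b v v') :
    IsPrimitiveOn a b (fun x => u x + v x) (fun x => u' x + v' x) := by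
  refine ⟨hu.integrable.add hv.integrable, fun x hx => ?_⟩
  rw [intervalIntegral.integral_add (hu.mono_right hx).integrable (hv.mono_right hx).integrable,
    hu.eq_add_integral x hx, hv.eq_add_integral x hx]
  ring

theorem const_mul (c : ℂ) (hu : IsPrimitiveOn a b u u') :
    IsPrimitiveOn a b (fun x => c * u x) (fun x => c * u' x) := by
  refine ⟨hu.integrable.const_mul c, fun x hx => ?_⟩
  rw [intervalIntegral.integral_const_mul, hu.eq_add_integral x hx]
  ring

theorem mul (hab : a ≤ b) (hu : IsPrimitiveOn a b u u') (hv : IsPrimitiveOn a b v v') :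
    IsPrimitiveOn a b (fun x => u x * v x) (fun x => u' x * v x + u x * v' x) := by
  refine of_absolutelyContinuous hab
    ((hu.absolutelyContinuous hab).smul (hv.absolutelyContinuous hab)) ?_ ?_
  · have h1 := hu.continuousOn hab
    have h2 := hv.continuousOn hab
    rw [← uIcc_of_le hab] at h1 h2
    exact (hu.integrable.mul_continuousOn h2).add (hv.integrable.continuousOn_mul h1)
  · filter_upwards [hu.ae_hasDerivAt, hv.ae_hasDerivAt] with x h1 h2 hx
    exact (h1 hx).mul (h2 hx)

theorem inv (hab : a ≤ b) (hu : IsPrimitiveOn a b u u') (h0 : ∀ x ∈ Icc a b, u x ≠ 0) :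
    IsPrimitiveOn a b (fun x => (u x)⁻¹) (fun x => -u' x / u x ^ 2) := by
  have hc := hu.continuousOn hab
  have hci : ContinuousOn (fun x => (u x)⁻¹) (Icc a b) := hc.inv₀ h0
  obtain ⟨C, hC⟩ := isCompact_Icc.exists_bound_of_continuousOn hci
  refine of_absolutelyContinuous hab
    (absolutelyContinuousOnInterval_of_dist_le (C := C * C) (hu.absolutelyContinuous hab) ?_) ?_ ?_
  · intro x hx y hy
    rw [uIcc_of_le hab] at hx hy
    have h1 : (u x)⁻¹ - (u y)⁻¹ = (u x)⁻¹ * (u y)⁻¹ * (u y - u x) := by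
      field_simp [h0 x hx, h0 y hy]
    rw [dist_eq_norm, dist_comm, dist_eq_norm, h1, norm_mul, norm_mul]
    exact mul_le_mul_of_nonneg_right (mul_le_mul (hC x hx) (hC y hy) (norm_nonneg _)
      ((norm_nonneg _).trans (hC x hx))) (norm_nonneg _)
  · have h2 : ContinuousOn (fun x => (u x ^ 2)⁻¹) (uIcc a b) := by
      rw [uIcc_of_le hab]
      exact (hc.pow 2).inv₀ fun x hx => pow_ne_zero 2 (h0 x hx)
    simpa [div_eq_mul_inv] using hu.integrable.neg.mul_continuousOn h2
  · filter_upwards [hu.ae_hasDerivAt] with x h1 hx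
    exact (h1 hx).inv (h0 x (Ioo_subset_Icc_self hx))

theorem integral_eq (hab : a ≤ b) (hu : IsPrimitiveOn a b u u') :
    ∫ t in a..b, u' t = u b - u a := by
  rw [hu.eq_add_integral b (right_mem_Icc.2 hab)]
  ring

theorem integral_mul_eq (hab : a ≤ b) (hu : IsPrimitiveOn a b u u')
    (hv : IsPrimitiveOn a b v v') :
    ∫ t in a..b, u t * v' t = u b * v b - u a * v a - ∫ t in a..b, u' t * v t := by
  have h := (hu.mul hab hv).integral_eq hab
  have h1 := hu.continuousOn hab
  have h2 := hv.continuousOn hab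
  rw [← uIcc_of_le hab] at h1 h2
  rw [intervalIntegral.integral_add (hu.integrable.mul_continuousOn h2)
    (hv.integrable.continuousOn_mul h1)] at h
  rw [← h]
  ring

end IsPrimitiveOn

/-! ### Weak derivatives -/

theorem integral_Ioo_eq_intervalIntegral {a b : ℝ} (hab : a ≤ b) (g : ℝ → ℂ) :
    ∫ x in Ioo a b, g x = ∫ x in a..b, g x := by
  rw [intervalIntegral.integral_of_le hab, integral_Ioc_eq_integral_Ioo]

theorem integrableOn_Ioo_iff {a b : ℝ} (hab : a ≤ b) (g : ℝ → ℂ) :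
    IntegrableOn g (Ioo a b) ↔ IntervalIntegrable g volume a b := by
  rw [intervalIntegrable_iff_integrableOn_Ioo_of_le hab]

namespace IsTest

variable {a b : ℝ} {φ : ℝ → ℂ}

theorem isPrimitiveOn (hφ : IsTest a b φ) : IsPrimitiveOn a b φ (deriv φ) :=
  .of_hasDerivAt (fun x => (hφ.1.differentiable (by simp) x).hasDerivAt)
    (hφ.1.continuous_deriv (by simp))

theorem eq_zero_of_notMem (hφ : IsTest a b φ) {x : ℝ} (hx : x ∉ Ioo a b) : φ x = 0 :=
  image_eq_zero_of_notMem_tsupport fun h => hx (hφ.2.2 h)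

end IsTest

theorem IsPrimitiveOn.weak {a b : ℝ} {u u' φ : ℝ → ℂ} (hab : a ≤ b) (hu : IsPrimitiveOn a b u u')
    (hφ : IsTest a b φ) :
    ∫ x in Ioo a b, u x * deriv φ x = -∫ x in Ioo a b, u' x * φ x := by
  rw [integral_Ioo_eq_intervalIntegral hab, integral_Ioo_eq_intervalIntegral hab,
    hu.integral_mul_eq hab (hφ.isPrimitiveOn), hφ.eq_zero_of_notMem (x := a) (by simp),
    hφ.eq_zero_of_notMem (x := b) (by simp)]
  simp

/-- A test function with vanishing integral is the derivative of a test function. -/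
theorem IsTest.exists_deriv_eq {a b : ℝ} {ψ : ℝ → ℂ} (hψ : IsTest a b ψ)
    (h0 : ∫ x in a..b, ψ x = 0) : ∃ φ, IsTest a b φ ∧ deriv φ = ψ := by
  have hc := hψ.1.continuous
  have hd : ∀ x, HasDerivAt (fun x => ∫ t in a..x, ψ t) (ψ x) x := fun x =>
    intervalIntegral.integral_hasDerivAt_right (hc.intervalIntegrable _ _)
      (hc.stronglyMeasurableAtFilter _ _) hc.continuousAt
  have hderiv : deriv (fun x => ∫ t in a..x, ψ t) = ψ := funext fun x => (hd x).deriv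
  obtain ⟨c, d, hcd⟩ : ∃ c d, a < c ∧ d < b ∧ tsupport ψ ⊆ Icc c d := by
    rcases (tsupport ψ).eq_empty_or_nonempty with he | hne
    -- For empty support any `c > a` and `d < b` serve; `c ≤ d` is not needed.
    · exact ⟨a + 1, b - 1, by linarith, by linarith, by simp [he]⟩
    · obtain ⟨c, hc1, hc2⟩ := hψ.2.1.isCompact.exists_isLeast hne
      obtain ⟨d, hd1, hd2⟩ := hψ.2.1.isCompact.exists_isGreatest hne
      exact ⟨c, d, (hψ.2.2 hc1).1, (hψ.2.2 hd1).2, fun x hx => ⟨hc2 hx, hd2 hx⟩⟩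
  have hz : ∀ x, x ∉ Icc c d → ψ x = 0 := fun x hx =>
    image_eq_zero_of_notMem_tsupport fun h => hx (hcd.2.2 h)
  have hsupp : Function.support (fun x => ∫ t in a..x, ψ t) ⊆ Icc c d := by
    intro x hx
    by_contra hxcd
    apply hx
    rw [mem_Icc, not_and_or, not_le, not_le] at hxcd
    rcases hxcd with h | h
    · have : EqOn ψ (fun _ => 0) (uIcc a x) := by
        intro t ht
        refine hz t fun htc => ?_
        rcases mem_uIcc.1 ht with h1 | h1 <;> linarith [htc.1, h1.1, h1.2, hcd.1]
      simp [intervalIntegral.integral_congr this]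
    -- Beyond `d` the primitive is the total integral, which vanishes, minus an integral of zero
    -- over `[x, b]`.
    · have : EqOn ψ (fun _ => 0) (uIcc x b) := by
        intro t ht
        refine hz t fun htc => ?_
        rcases mem_uIcc.1 ht with h1 | h1 <;> linarith [htc.2, h1.1, h1.2, hcd.2.1]
      have h2 := intervalIntegral.integral_add_adjacent_intervals
        (hc.intervalIntegrable (μ := volume) a x) (hc.intervalIntegrable x b)
      rw [intervalIntegral.integral_congr this, h0] at h2
      simpa using h2
  have hts : tsupport (fun x => ∫ t in a..x, ψ t) ⊆ Icc c d := closure_minimal hsupp isClosed_Icc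
  refine ⟨_, ⟨?_, HasCompactSupport.of_support_subset_isCompact isCompact_Icc hsupp,
    hts.trans fun x hx => ⟨hcd.1.trans_le hx.1, hx.2.trans_lt hcd.2.1⟩⟩, hderiv⟩
  exact contDiff_infty_iff_deriv.2 ⟨fun x => (hd x).differentiableAt, by rw [hderiv]; exact hψ.1⟩

theorem exists_isTest_integral_eq_one {a b : ℝ} (hab : a < b) :
    ∃ η, IsTest a b η ∧ ∫ x in a..b, η x = 1 := by
  let B : ContDiffBump ((a + b) / 2) := ⟨(b - a) / 8, (b - a) / 4, by linarith, by linarith⟩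
  have hs : tsupport (B.normed volume) ⊆ Ioo a b := by
    rw [B.tsupport_normed_eq, Real.closedBall_eq_Icc]
    intro x hx
    have h1 := hx.1
    have h2 := hx.2
    simp only [B] at h1 h2
    constructor <;> linarith
  have hsC : tsupport (fun x => ((B.normed volume x : ℝ) : ℂ)) ⊆ tsupport (B.normed volume) :=
    closure_mono fun x hx => by
      intro h
      exact hx (by simp [h])
  refine ⟨fun x => (B.normed volume x : ℂ), ⟨?_, ?_, hsC.trans hs⟩, ?_⟩
  · exact Complex.ofRealCLM.contDiff.comp B.contDiff_normed
  · exact B.hasCompactSupport_normed.mono' ((subset_tsupport _).trans hsC)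
  · rw [intervalIntegral.integral_ofReal, intervalIntegral.integral_of_le hab.le,
      setIntegral_eq_integral_of_forall_compl_eq_zero, B.integral_normed]
    · simp
    · intro x hx
      exact image_eq_zero_of_notMem_tsupport fun h => hx (Ioo_subset_Ioc_self (hs h))

/-- The lemma of du Bois-Reymond: a function with integrable weak derivative is almost everywhere
equal to a primitive of it. -/
theorem exists_ae_eq_const_add_integral {a b : ℝ} (hab : a < b) {u u' : ℝ → ℂ}
    (hu : IntervalIntegrable u volume a b) (hu' : IntervalIntegrable u' volume a b)
    (hw : ∀ φ, IsTest a b φ →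
      ∫ x in Ioo a b, u x * deriv φ x = -∫ x in Ioo a b, u' x * φ x) :
    ∃ c : ℂ, ∀ᵐ x, x ∈ Ioo a b → u x = c + ∫ t in a..x, u' t := by
  have hP : IsPrimitiveOn a b (fun x => ∫ t in a..x, u' t) u' := ⟨hu', by simp⟩
  have hPc := hP.continuousOn hab.le
  rw [← uIcc_of_le hab.le] at hPc
  set g : ℝ → ℂ := fun x => u x - ∫ t in a..x, u' t with hg
  have hgi : IntervalIntegrable g volume a b := hu.sub hPc.intervalIntegrable
  have hcont : ∀ {ψ : ℝ → ℂ}, IsTest a b ψ → ContinuousOn ψ (uIcc a b) := fun h =>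
    h.1.continuous.continuousOn
  have hg0 : ∀ φ, IsTest a b φ → ∫ x in a..b, g x * deriv φ x = 0 := by
    intro φ hφ
    have h1 := hw φ hφ
    have h2 := hP.weak hab.le hφ
    have hdc : ContinuousOn (deriv φ) (uIcc a b) := (hφ.1.continuous_deriv (by simp)).continuousOn
    rw [← h2, integral_Ioo_eq_intervalIntegral hab.le, integral_Ioo_eq_intervalIntegral hab.le] at h1
    simp only [hg, sub_mul]
    rw [intervalIntegral.integral_sub (hu.mul_continuousOn hdc)
      (hPc.intervalIntegrable.mul_continuousOn hdc), h1, sub_self]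
  obtain ⟨η, hη, hη1⟩ := exists_isTest_integral_eq_one hab
  -- Since `∫ η = 1`, this is the only value that a constant `g` could have.
  refine ⟨∫ x in a..b, g x * η x, ?_⟩
  have key := IsOpen.ae_eq_zero_of_integral_contDiff_smul_eq_zero (μ := volume)
    (f := fun x => g x - ∫ x in a..b, g x * η x) isOpen_Ioo (U := Ioo a b)
    (((integrableOn_Ioo_iff hab.le _).2
      (hgi.sub intervalIntegrable_const)).locallyIntegrableOn) ?_
  · filter_upwards [key] with x hx hxab
    have := hx hxab
    simp only [hg] at this
    linear_combination this
  · intro ψ hψ1 hψ2 hψ3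
    have hsC : tsupport (fun x => (ψ x : ℂ)) ⊆ tsupport ψ := closure_mono fun x hx h =>
      hx (by simp [h])
    have hψ : IsTest a b (fun x => (ψ x : ℂ)) :=
      ⟨Complex.ofRealCLM.contDiff.comp hψ1, hψ2.mono' ((subset_tsupport _).trans hsC),
        hsC.trans hψ3⟩
    set c := ∫ x in a..b, g x * η x with hc
    set m := ∫ x in a..b, (ψ x : ℂ) with hm
    -- Subtracting `m η` removes the mean of `ψ`, so that the result is the derivative of a test
    -- function.
    have hη2 : IsTest a b (fun x => (ψ x : ℂ) - m * η x) := by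
      refine ⟨hψ.1.sub (contDiff_const.mul hη.1), hψ.2.1.sub hη.2.1.mul_left, ?_⟩
      refine (tsupport_sub _ _).trans (union_subset hψ.2.2 ?_)
      exact (tsupport_mul_subset_right (f := fun _ => m)).trans hη.2.2
    obtain ⟨φ, hφ, hφ'⟩ := hη2.exists_deriv_eq (by
      rw [intervalIntegral.integral_sub (hψ.1.continuous.intervalIntegrable _ _)
        ((hη.1.continuous.intervalIntegrable _ _).const_mul m),
        intervalIntegral.integral_const_mul, hη1, ← hm]
      ring)
    have h1 := hg0 φ hφ
    rw [hφ'] at h1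
    have h2 : ∫ x in a..b, g x * ((ψ x : ℂ) - m * η x)
        = (∫ x in a..b, g x * (ψ x : ℂ)) - m * c := by
      rw [hc, ← intervalIntegral.integral_const_mul, ← intervalIntegral.integral_sub]
      · refine intervalIntegral.integral_congr fun x _ => ?_
        ring
      · exact hgi.mul_continuousOn (hcont hψ)
      · exact (hgi.mul_continuousOn (hcont hη)).const_mul m
    have h3 : ∫ x, ψ x • (g x - c) = ∫ x in a..b, (g x * (ψ x : ℂ) - c * ψ x) := by
      rw [intervalIntegral.integral_of_le hab.le]
      rw [setIntegral_eq_integral_of_forall_compl_eq_zero]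
      · refine integral_congr_ae (.of_forall fun x => ?_)
        simp only [Complex.real_smul]
        ring
      · intro x hx
        have : ψ x = 0 :=
          image_eq_zero_of_notMem_tsupport fun h => hx (Ioo_subset_Ioc_self (hψ3 h))
        simp [this]
    rw [h3, intervalIntegral.integral_sub (hgi.mul_continuousOn (hcont hψ))
      ((hψ.1.continuous.intervalIntegrable _ _).const_mul c),
      intervalIntegral.integral_const_mul, ← hm]
    rw [h2] at h1
    linear_combination h1

theorem continuousOn_Icc_eqOn_of_ae {a b : ℝ} (hab : a < b) {u v : ℝ → ℂ}
    (hu : ContinuousOn u (Icc a b)) (hv : ContinuousOn v (Icc a b))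
    (h : ∀ᵐ x, x ∈ Ioo a b → u x = v x) : EqOn u v (Icc a b) := by
  refine Measure.eqOn_Icc_of_ae_eq volume hab.ne ?_ hu hv
  rw [Filter.EventuallyEq, ← restrict_Ioo_eq_restrict_Icc]
  exact (ae_restrict_iff' measurableSet_Ioo).2 h

theorem isPrimitiveOn_of_weak {a b : ℝ} (hab : a < b) {u u' : ℝ → ℂ}
    (hu : ContinuousOn u (Icc a b)) (hu' : IntervalIntegrable u' volume a b)
    (hw : ∀ φ, IsTest a b φ →
      ∫ x in Ioo a b, u x * deriv φ x = -∫ x in Ioo a b, u' x * φ x) :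
    IsPrimitiveOn a b u u' := by
  obtain ⟨c, hc⟩ := exists_ae_eq_const_add_integral hab
    (by rw [← uIcc_of_le hab.le] at hu; exact hu.intervalIntegrable) hu' hw
  have hP : IsPrimitiveOn a b (fun x => c + ∫ t in a..x, u' t) u' := ⟨hu', by simp⟩
  exact hP.congr hab.le (continuousOn_Icc_eqOn_of_ae hab hu (hP.continuousOn hab.le) hc).symm

theorem memLp_two_intervalIntegrable {a b : ℝ} (hab : a ≤ b) {u : ℝ → ℂ}
    (hu : MemLp u 2 (volume.restrict (Ioo a b))) : IntervalIntegrable u volume a b :=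
  (integrableOn_Ioo_iff hab u).1 (hu.integrable (by norm_num))

theorem continuousOn_memLp_top {a b : ℝ} {u : ℝ → ℂ} (hu : ContinuousOn u (Icc a b)) :
    MemLp u ⊤ (volume.restrict (Ioo a b)) := by
  obtain ⟨C, hC⟩ := isCompact_Icc.exists_bound_of_continuousOn hu
  refine memLp_top_of_bound ((hu.mono Ioo_subset_Icc_self).aestronglyMeasurable
    measurableSet_Ioo) C ?_
  filter_upwards [ae_restrict_mem measurableSet_Ioo] with x hx
  exact hC x (Ioo_subset_Icc_self hx)

theorem continuousOn_memLp_two {a b : ℝ} {u : ℝ → ℂ} (hu : ContinuousOn u (Icc a b)) :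
    MemLp u 2 (volume.restrict (Ioo a b)) :=
  (continuousOn_memLp_top hu).mono_exponent le_top

theorem memLp_two_mul_continuousOn {a b : ℝ} {u v : ℝ → ℂ}
    (hu : MemLp u 2 (volume.restrict (Ioo a b))) (hv : ContinuousOn v (Icc a b)) :
    MemLp (fun x => u x * v x) 2 (volume.restrict (Ioo a b)) :=
  (continuousOn_memLp_top hv).mul hu

theorem memLp_two_mul_integrable {a b : ℝ} {u v : ℝ → ℂ}
    (hu : MemLp u 2 (volume.restrict (Ioo a b))) (hv : MemLp v 2 (volume.restrict (Ioo a b))) :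
    IntegrableOn (fun x => u x * v x) (Ioo a b) :=
  hu.integrable_mul hv

theorem HasW12Deriv.isPrimitiveOn {a b : ℝ} (hab : a < b) {u u' : ℝ → ℂ}
    (h : HasW12Deriv a b u u') (hc : ContinuousOn u (Icc a b)) : IsPrimitiveOn a b u u' :=
  isPrimitiveOn_of_weak hab hc (memLp_two_intervalIntegrable hab.le h.memLp_deriv) h.weak

theorem IsPrimitiveOn.hasW12Deriv {a b : ℝ} (hab : a ≤ b) {u u' : ℝ → ℂ}
    (h : IsPrimitiveOn a b u u') (hu' : MemLp u' 2 (volume.restrict (Ioo a b))) :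
    HasW12Deriv a b u u' :=
  ⟨continuousOn_memLp_two (h.continuousOn hab), hu', fun _ hφ => h.weak hab hφ⟩

/-! ### First order systems -/

/-- The equation `-(1/f²) (f² v')' = ρ² v` as a first order system for `v` and `W = f² v'`. -/
structure IsImpedanceSystem (ℓ : ℝ) (f : ℝ → ℂ) (ρ : ℂ) (v W : ℝ → ℂ) : Prop where
  fst : IsPrimitiveOn 0 ℓ v (fun x => W x / f x ^ 2)
  snd : IsPrimitiveOn 0 ℓ W (fun x => -(f x ^ 2 * (ρ ^ 2 * v x)))
  fst_zero : v 0 = 1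
  snd_zero : W 0 = Complex.I * ρ

/-- The equation `S_f y = ρ² y` as a first order system for `y` and `w = y' - (f'/f) y`. -/
structure IsSchrodingerSystem (ℓ : ℝ) (f f' : ℝ → ℂ) (ρ : ℂ) (y w : ℝ → ℂ) : Prop where
  fst : IsPrimitiveOn 0 ℓ y (fun x => f' x / f x * y x + w x)
  snd : IsPrimitiveOn 0 ℓ w (fun x => -(f' x / f x * w x) - ρ ^ 2 * y x)
  fst_zero : y 0 = 1
  snd_zero : w 0 = Complex.I * ρ

/-- Gronwall's inequality needs right derivatives at every point, the left end included; continuity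
of `u'` supplies them. -/
theorem IsPrimitiveOn.hasDerivWithinAt {a b : ℝ} {u u' : ℝ → ℂ} (hu : IsPrimitiveOn a b u u')
    (hc : ContinuousOn u' (Icc a b)) {x : ℝ} (hx : x ∈ Ico a b) :
    HasDerivWithinAt u (u' x) (Ici x) x := by
  have hx' := Ico_subset_Icc_self hx
  have hcx : ContinuousWithinAt u' (Ici x) x :=
    (hc x hx').mono_of_mem_nhdsWithin
      (Filter.mem_of_superset (Icc_mem_nhdsGE hx.2) (Icc_subset_Icc_left hx.1))
  have hm : StronglyMeasurableAtFilter u' (nhdsWithin x (Ioi x)) volume :=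
    ⟨Ioo x b, Ioo_mem_nhdsGT hx.2, (hc.mono fun y hy =>
      ⟨hx.1.trans hy.1.le, hy.2.le⟩).aestronglyMeasurable measurableSet_Ioo⟩
  have h1 := (intervalIntegral.integral_hasDerivWithinAt_right (s := Ici x) (t := Ioi x)
    (hu.mono_right hx').integrable hm (hcx.mono Ioi_subset_Ici_self)).const_add (u a)
  refine h1.congr_of_eventuallyEq ?_ (hu.eq_add_integral x hx')
  filter_upwards [Icc_mem_nhdsGE hx.2] with y hy
  exact hu.eq_add_integral y ⟨hx.1.trans hy.1, hy.2⟩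

/-- Gronwall for the difference of two solutions: the coefficients `1/f²` and `ρ² f²` are bounded,
by `C` and `D`, and no derivative of `f` occurs. -/
theorem IsImpedanceSystem.unique {ℓ : ℝ} (hℓ : 0 ≤ ℓ) {f : ℝ → ℂ} {ρ : ℂ}
    (hfc : ContinuousOn f (Icc 0 ℓ)) (hf_ne : ∀ x ∈ Icc 0 ℓ, f x ≠ 0) {v₁ W₁ v₂ W₂ : ℝ → ℂ}
    (h₁ : IsImpedanceSystem ℓ f ρ v₁ W₁) (h₂ : IsImpedanceSystem ℓ f ρ v₂ W₂) :
    EqOn v₁ v₂ (Icc 0 ℓ) := by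
  have hf2 := hfc.pow 2
  have hf2n : ∀ x ∈ Icc 0 ℓ, f x ^ 2 ≠ 0 := fun x hx => pow_ne_zero 2 (hf_ne x hx)
  have cv₁ := h₁.fst.continuousOn hℓ
  have cv₂ := h₂.fst.continuousOn hℓ
  have cW₁ := h₁.snd.continuousOn hℓ
  have cW₂ := h₂.snd.continuousOn hℓ
  obtain ⟨C, hC⟩ := isCompact_Icc.exists_bound_of_continuousOn (hf2.inv₀ hf2n)
  obtain ⟨D, hD⟩ := isCompact_Icc.exists_bound_of_continuousOn
    (hf2.mul (continuousOn_const (c := ρ ^ 2)))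
  have key := eq_zero_of_abs_deriv_le_mul_abs_self_of_eq_zero_right (K := max C D)
    (f := fun x => (v₁ x - v₂ x, W₁ x - W₂ x))
    (f' := fun x => (W₁ x / f x ^ 2 - W₂ x / f x ^ 2,
      -(f x ^ 2 * (ρ ^ 2 * v₁ x)) - -(f x ^ 2 * (ρ ^ 2 * v₂ x))))
    (a := 0) (b := ℓ) ((cv₁.sub cv₂).prodMk (cW₁.sub cW₂)) ?_ ?_ ?_
  · intro x hx
    have := congrArg Prod.fst (key x hx)
    exact sub_eq_zero.1 this
  · intro x hx
    refine HasDerivWithinAt.prodMk ?_ ?_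
    · exact (h₁.fst.hasDerivWithinAt (cW₁.div hf2 hf2n) hx).sub
        (h₂.fst.hasDerivWithinAt (cW₂.div hf2 hf2n) hx)
    · exact (h₁.snd.hasDerivWithinAt (hf2.mul (continuousOn_const.mul cv₁)).neg hx).sub
        (h₂.snd.hasDerivWithinAt (hf2.mul (continuousOn_const.mul cv₂)).neg hx)
  · simp [h₁.fst_zero, h₂.fst_zero, h₁.snd_zero, h₂.snd_zero]
  · intro x hx
    have hx' := Ico_subset_Icc_self hx
    have e1 : W₁ x / f x ^ 2 - W₂ x / f x ^ 2 = (f x ^ 2)⁻¹ * (W₁ x - W₂ x) := by ring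
    have e2 : -(f x ^ 2 * (ρ ^ 2 * v₁ x)) - -(f x ^ 2 * (ρ ^ 2 * v₂ x))
        = -(f x ^ 2 * ρ ^ 2 * (v₁ x - v₂ x)) := by ring
    rw [e1, e2, Prod.norm_def, Prod.norm_def]
    refine max_le ?_ ?_
    · rw [norm_mul]
      exact mul_le_mul ((hC x hx').trans (le_max_left _ _)) (le_max_right _ _) (norm_nonneg _)
        (((norm_nonneg _).trans (hC x hx')).trans (le_max_left _ _))
    · rw [norm_neg, norm_mul]
      exact mul_le_mul ((hD x hx').trans (le_max_right _ _)) (le_max_left _ _) (norm_nonneg _)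
        (((norm_nonneg _).trans (hC x hx')).trans (le_max_left _ _))

/-! ### Equivalence of the weak equations with the first order systems -/

section Equivalence

variable {ℓ : ℝ} {f f' : ℝ → ℂ} {ρ : ℂ}

theorem memLp_two_logDeriv (hf : HasW12Deriv 0 ℓ f f') (hfc : ContinuousOn f (Icc 0 ℓ))
    (hf_ne : ∀ x ∈ Icc 0 ℓ, f x ≠ 0) :
    MemLp (fun x => f' x / f x) 2 (volume.restrict (Ioo 0 ℓ)) := by
  simp only [div_eq_mul_inv]
  exact memLp_two_mul_continuousOn hf.memLp_deriv (hfc.inv₀ hf_ne)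

theorem IsImpedanceExp.exists_isImpedanceSystem (hℓ : 0 < ℓ) (hfc : ContinuousOn f (Icc 0 ℓ))
    (hf_ne : ∀ x ∈ Icc 0 ℓ, f x ≠ 0) (hf_zero : f 0 = 1) {v : ℝ → ℂ}
    (h : IsImpedanceExp ℓ f ρ v) : ∃ W, IsImpedanceSystem ℓ f ρ v W := by
  obtain ⟨v', v'', hv, hv', h1, -, h2, h3, h4⟩ := h
  refine ⟨fun x => f x ^ 2 * v' x, ?_, h2.isPrimitiveOn hℓ ((hfc.pow 2).mul hv'), h3,
    by simp [hf_zero, h4]⟩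
  refine (h1.isPrimitiveOn hℓ hv).congr_deriv hℓ.le (.of_forall fun x hx => ?_)
  field_simp [hf_ne x (Ioo_subset_Icc_self hx)]

theorem IsImpedanceSystem.isImpedanceExp (hℓ : 0 < ℓ) (hf : HasW12Deriv 0 ℓ f f')
    (hfc : ContinuousOn f (Icc 0 ℓ)) (hf_ne : ∀ x ∈ Icc 0 ℓ, f x ≠ 0) (hf_zero : f 0 = 1)
    {v W : ℝ → ℂ} (h : IsImpedanceSystem ℓ f ρ v W) : IsImpedanceExp ℓ f ρ v := by
  have hF := hf.isPrimitiveOn hℓ hfc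
  have hv := h.fst.continuousOn hℓ.le
  have hW := h.snd.continuousOn hℓ.le
  have hf2 := hfc.pow 2
  have hf2n : ∀ x ∈ Icc 0 ℓ, f x * f x ≠ 0 := fun x hx => mul_ne_zero (hf_ne x hx) (hf_ne x hx)
  have hf2n' : ∀ x ∈ Icc 0 ℓ, f x ^ 2 ≠ 0 := fun x hx => pow_ne_zero 2 (hf_ne x hx)
  have hv' := h.snd.mul hℓ.le ((hF.mul hℓ.le hF).inv hℓ.le hf2n)
  have hv'c : ContinuousOn (fun x => W x / f x ^ 2) (Icc 0 ℓ) := hW.div hf2 hf2n'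
  have hgc : ContinuousOn (fun x => -(f x ^ 2 * (ρ ^ 2 * v x))) (Icc 0 ℓ) :=
    (hf2.mul (continuousOn_const.mul hv)).neg
  refine ⟨_, _, hv, hv'c, h.fst.hasW12Deriv hℓ.le (continuousOn_memLp_two hv'c),
    (hv'.congr hℓ.le (v := fun x => W x / f x ^ 2) fun x _ => by ring).hasW12Deriv hℓ.le ?_,
    (h.snd.congr hℓ.le fun x hx => ?_).hasW12Deriv hℓ.le (continuousOn_memLp_two hgc), h.fst_zero,
    by simp [hf_zero, h.snd_zero]⟩
  -- The second derivative is a continuous function plus `f'` times a continuous function, hence in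
  -- `L²`.
  · have hi : ContinuousOn (fun x => (f x * f x)⁻¹) (Icc 0 ℓ) := (hfc.mul hfc).inv₀ hf2n
    have hi2 : ContinuousOn (fun x => -(2 * W x * f x / (f x * f x) ^ 2)) (Icc 0 ℓ) :=
      (((continuousOn_const.mul hW).mul hfc).div ((hfc.mul hfc).pow 2)
        fun x hx => pow_ne_zero 2 (hf2n x hx)).neg
    refine ((continuousOn_memLp_two (hgc.mul hi)).add
      (memLp_two_mul_continuousOn hf.memLp_deriv hi2)).ae_eq (.of_forall fun x => ?_)
    simp only [Pi.add_apply, Pi.mul_apply]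
    ring
  · have := hf_ne x hx
    field_simp

/-- The terms with `f'/f` cancel: `(y/f)' = w/f` and `(f w)' = -ρ² f y`. -/
theorem IsSchrodingerSystem.isImpedanceSystem (hℓ : 0 < ℓ) (hf : HasW12Deriv 0 ℓ f f')
    (hfc : ContinuousOn f (Icc 0 ℓ)) (hf_ne : ∀ x ∈ Icc 0 ℓ, f x ≠ 0) (hf_zero : f 0 = 1)
    {y w : ℝ → ℂ} (h : IsSchrodingerSystem ℓ f f' ρ y w) :
    IsImpedanceSystem ℓ f ρ (fun x => y x / f x) (fun x => f x * w x) := by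
  have hF := hf.isPrimitiveOn hℓ hfc
  refine ⟨?_, ?_, by simp [h.fst_zero, hf_zero], by simp [h.snd_zero, hf_zero]⟩
  · refine (h.fst.mul hℓ.le (hF.inv hℓ.le hf_ne)).congr_deriv hℓ.le (.of_forall fun x hx => ?_)
    have := hf_ne x (Ioo_subset_Icc_self hx)
    field_simp
    ring
  · refine (hF.mul hℓ.le h.snd).congr_deriv hℓ.le (.of_forall fun x hx => ?_)
    have := hf_ne x (Ioo_subset_Icc_self hx)
    field_simp
    ring

/-- The integrand of `(S_f y | φ)` in terms of `w = y' - (f'/f) y`. -/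
theorem schrodingerPairing_eq (hf : HasW12Deriv 0 ℓ f f')
    (hfc : ContinuousOn f (Icc 0 ℓ)) (hf_ne : ∀ x ∈ Icc 0 ℓ, f x ≠ 0) {y y' w φ : ℝ → ℂ}
    (hy : ContinuousOn y (Icc 0 ℓ)) (hy' : MemLp y' 2 (volume.restrict (Ioo 0 ℓ)))
    (hw : ContinuousOn w (Icc 0 ℓ))
    (hyw : ∀ᵐ x ∂volume.restrict (Ioo 0 ℓ), w x = y' x - f' x / f x * y x)
    (hφ : IsTest 0 ℓ φ) :
    schrodingerPairing ℓ f f' y y' φ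
      = (∫ x in Ioo 0 ℓ, w x * deriv φ x) - ∫ x in Ioo 0 ℓ, f' x / f x * w x * φ x := by
  have hσ := memLp_two_logDeriv hf hfc hf_ne
  have cφ : ContinuousOn φ (Icc 0 ℓ) := hφ.1.continuous.continuousOn
  have cφ' : ContinuousOn (deriv φ) (Icc 0 ℓ) := (hφ.1.continuous_deriv (by simp)).continuousOn
  have i1 : IntegrableOn (fun x => y' x * deriv φ x) (Ioo 0 ℓ) :=
    (memLp_two_mul_continuousOn hy' cφ').integrable (by norm_num)
  have i2 : IntegrableOn (fun x => w x * deriv φ x) (Ioo 0 ℓ) :=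
    (continuousOn_memLp_two (hw.mul cφ')).integrable (by norm_num)
  have i3 : IntegrableOn (fun x => f' x / f x * w x * φ x) (Ioo 0 ℓ) :=
    (memLp_two_mul_continuousOn (memLp_two_mul_continuousOn hσ hw) cφ).integrable (by norm_num)
  have i4 : IntegrableOn (fun x => (f' x / f x) ^ 2 * (y x * φ x)
      - f' x / f x * (y' x * φ x + y x * deriv φ x)) (Ioo 0 ℓ) := by
    have a1 := memLp_two_mul_integrable hσ (memLp_two_mul_continuousOn hσ (hy.mul cφ))
    have a2 := memLp_two_mul_integrable hσ
      ((memLp_two_mul_continuousOn hy' cφ).add (continuousOn_memLp_two (hy.mul cφ')))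
    refine (a1.sub a2).congr (.of_forall fun x => ?_)
    simp only [Pi.sub_apply, Pi.add_apply, Pi.mul_apply]
    ring
  -- With `σ = f'/f` the whole integrand factors as `(y' - σ y)(φ' - σ φ)`.
  rw [schrodingerPairing, potentialPairing, ← integral_add i1 i4, ← integral_sub i2 i3]
  refine integral_congr_ae ?_
  filter_upwards [hyw] with x hx
  simp only [hx]
  ring

theorem intervalIntegrable_logDeriv_mul_sub (hℓ : 0 < ℓ) (hf : HasW12Deriv 0 ℓ f f')
    (hfc : ContinuousOn f (Icc 0 ℓ)) (hf_ne : ∀ x ∈ Icc 0 ℓ, f x ≠ 0) {y w : ℝ → ℂ}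
    (hy : ContinuousOn y (Icc 0 ℓ)) (hw : ContinuousOn w (Icc 0 ℓ)) (c : ℂ) :
    IntervalIntegrable (fun x => -(f' x / f x * w x) - c * y x) volume 0 ℓ :=
  memLp_two_intervalIntegrable hℓ.le
    ((memLp_two_mul_continuousOn (memLp_two_logDeriv hf hfc hf_ne) hw).neg.sub
      (continuousOn_memLp_two (continuousOn_const.mul hy)))

theorem neg_integral_logDeriv_mul_sub (hf : HasW12Deriv 0 ℓ f f')
    (hfc : ContinuousOn f (Icc 0 ℓ)) (hf_ne : ∀ x ∈ Icc 0 ℓ, f x ≠ 0) {y w φ : ℝ → ℂ}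
    (hy : ContinuousOn y (Icc 0 ℓ)) (hw : ContinuousOn w (Icc 0 ℓ)) (hφ : IsTest 0 ℓ φ) :
    -∫ x in Ioo 0 ℓ, (-(f' x / f x * w x) - ρ ^ 2 * y x) * φ x
      = (∫ x in Ioo 0 ℓ, f' x / f x * w x * φ x) + ∫ x in Ioo 0 ℓ, ρ ^ 2 * y x * φ x := by
  have hσ := memLp_two_logDeriv hf hfc hf_ne
  have cφ : ContinuousOn φ (Icc 0 ℓ) := hφ.1.continuous.continuousOn
  have i3 : IntegrableOn (fun x => f' x / f x * w x * φ x) (Ioo 0 ℓ) :=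
    (memLp_two_mul_continuousOn (memLp_two_mul_continuousOn hσ hw) cφ).integrable (by norm_num)
  have i5 : IntegrableOn (fun x => ρ ^ 2 * y x * φ x) (Ioo 0 ℓ) :=
    (continuousOn_memLp_two ((continuousOn_const.mul hy).mul cφ)).integrable (by norm_num)
  rw [← integral_add i3 i5, ← integral_neg]
  refine integral_congr_ae (.of_forall fun x => ?_)
  simp only
  ring

/-- By `schrodingerPairing_eq` the equation says that `w` has weak derivative `-(f'/f) w - ρ² y`; du
Bois-Reymond makes `w` a primitive of it. -/
theorem IsSchrodingerExp.exists_isSchrodingerSystem (hℓ : 0 < ℓ) (hf : HasW12Deriv 0 ℓ f f')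
    (hfc : ContinuousOn f (Icc 0 ℓ)) (hf_ne : ∀ x ∈ Icc 0 ℓ, f x ≠ 0) {y : ℝ → ℂ}
    (h : IsSchrodingerExp ℓ f f' ρ y) : ∃ w, IsSchrodingerSystem ℓ f f' ρ y w := by
  obtain ⟨y', w, hy, hyy', heq, ⟨hw, hwy⟩, hy0, hw0⟩ := h
  refine ⟨w, ?_, ?_, hy0, hw0⟩
  · refine (hyy'.isPrimitiveOn hℓ hy).congr_deriv hℓ.le ?_
    filter_upwards [(ae_restrict_iff' measurableSet_Ioo).1 hwy] with x hx hx0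
    rw [hx hx0]
    ring
  · refine isPrimitiveOn_of_weak hℓ hw
      (intervalIntegrable_logDeriv_mul_sub hℓ hf hfc hf_ne hy hw _) fun φ hφ => ?_
    have h1 := heq φ hφ
    rw [schrodingerPairing_eq hf hfc hf_ne hy hyy'.memLp_deriv hw hwy hφ] at h1
    rw [neg_integral_logDeriv_mul_sub hf hfc hf_ne hy hw hφ]
    linear_combination h1

theorem IsSchrodingerSystem.isSchrodingerExp (hℓ : 0 < ℓ) (hf : HasW12Deriv 0 ℓ f f')
    (hfc : ContinuousOn f (Icc 0 ℓ)) (hf_ne : ∀ x ∈ Icc 0 ℓ, f x ≠ 0) {y w : ℝ → ℂ}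
    (h : IsSchrodingerSystem ℓ f f' ρ y w) : IsSchrodingerExp ℓ f f' ρ y := by
  have hy := h.fst.continuousOn hℓ.le
  have hw := h.snd.continuousOn hℓ.le
  have hy' : MemLp (fun x => f' x / f x * y x + w x) 2 (volume.restrict (Ioo 0 ℓ)) :=
    (memLp_two_mul_continuousOn (memLp_two_logDeriv hf hfc hf_ne) hy).add
      (continuousOn_memLp_two hw)
  have hwy : ∀ᵐ x ∂volume.restrict (Ioo 0 ℓ),
      w x = f' x / f x * y x + w x - f' x / f x * y x := .of_forall fun x => by ring
  refine ⟨_, w, hy, h.fst.hasW12Deriv hℓ.le hy', fun φ hφ => ?_, ⟨hw, hwy⟩, h.fst_zero,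
    h.snd_zero⟩
  rw [schrodingerPairing_eq hf hfc hf_ne hy hy' hw hwy hφ, h.snd.weak hℓ.le hφ,
    neg_integral_logDeriv_mul_sub hf hfc hf_ne hy hw hφ]
  ring

/-- The two exponentials are related by `e_f = f · ê_f`. -/
theorem IsSchrodingerExp.eq_mul (hℓ : 0 < ℓ) (hf : HasW12Deriv 0 ℓ f f')
    (hfc : ContinuousOn f (Icc 0 ℓ)) (hf_ne : ∀ x ∈ Icc 0 ℓ, f x ≠ 0) (hf_zero : f 0 = 1)
    {y v : ℝ → ℂ} (hy : IsSchrodingerExp ℓ f f' ρ y) (hv : IsImpedanceExp ℓ f ρ v)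
    {x : ℝ} (hx : x ∈ Icc 0 ℓ) : y x = f x * v x := by
  obtain ⟨w, hw⟩ := hy.exists_isSchrodingerSystem hℓ hf hfc hf_ne
  obtain ⟨W, hW⟩ := hv.exists_isImpedanceSystem hℓ hfc hf_ne hf_zero
  have := (hw.isImpedanceSystem hℓ hf hfc hf_ne hf_zero).unique hℓ.le hfc hf_ne hW hx
  rw [← this, mul_div_cancel₀ _ (hf_ne x hx)]

end Equivalence

/-! ### Uniqueness for Fourier integrals over an interval -/

theorem IsPrimitiveOn.mono {a b c d : ℝ} {u u' : ℝ → ℂ} (hu : IsPrimitiveOn a b u u')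
    (hc : c ∈ Icc a b) (hd : d ∈ Icc a b) : IsPrimitiveOn c d u u' := by
  refine ⟨hu.integrable.mono_set (uIcc_subset_uIcc (Icc_subset_uIcc hc) (Icc_subset_uIcc hd)),
    fun x hx => ?_⟩
  have hx' : x ∈ Icc a b := ⟨hc.1.trans hx.1, hx.2.trans hd.2⟩
  rw [hu.eq_add_integral x hx', hu.eq_add_integral c hc, add_assoc,
    intervalIntegral.integral_add_adjacent_intervals (hu.mono_right hc).integrable
      (hu.integrable.mono_set (uIcc_subset_uIcc (Icc_subset_uIcc hc) (Icc_subset_uIcc hx')))]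

theorem IsPrimitiveOn.ae_eq_zero {a b : ℝ} {u u' : ℝ → ℂ} (hu : IsPrimitiveOn a b u u')
    (h0 : ∀ x ∈ Ioo a b, u x = 0) : ∀ᵐ x, x ∈ Ioo a b → u' x = 0 := by
  filter_upwards [hu.ae_hasDerivAt] with x hx hxab
  have h1 : HasDerivAt u 0 x := (hasDerivAt_const x (0 : ℂ)).congr_of_eventuallyEq (by
    filter_upwards [Ioo_mem_nhds hxab.1 hxab.2] with y hy using h0 y hy)
  exact (hx hxab).unique h1

theorem HasW12Deriv.ae_unique {a b : ℝ} (hab : a < b) {u v w : ℝ → ℂ}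
    (hv : HasW12Deriv a b u v) (hw : HasW12Deriv a b u w) : ∀ᵐ x, x ∈ Ioo a b → v x = w x := by
  have hd := hv.memLp_deriv.sub hw.memLp_deriv
  have h0 : IsPrimitiveOn a b (fun _ => 0) (v - w) := by
    refine isPrimitiveOn_of_weak hab continuousOn_const (memLp_two_intervalIntegrable hab.le hd)
      fun φ hφ => ?_
    have cφ : ContinuousOn φ (Icc a b) := hφ.1.continuous.continuousOn
    have i1 : IntegrableOn (fun x => v x * φ x) (Ioo a b) :=
      (memLp_two_mul_continuousOn hv.memLp_deriv cφ).integrable (by norm_num)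
    have i2 : IntegrableOn (fun x => w x * φ x) (Ioo a b) :=
      (memLp_two_mul_continuousOn hw.memLp_deriv cφ).integrable (by norm_num)
    have h1 := (hv.weak φ hφ).symm.trans (hw.weak φ hφ)
    simp only [Pi.sub_apply, sub_mul, zero_mul, integral_zero]
    rw [integral_sub i1 i2, neg_inj.1 h1, sub_self, neg_zero]
  filter_upwards [h0.ae_eq_zero fun _ _ => rfl] with x hx hxab
  exact sub_eq_zero.1 (hx hxab)

/-- A continuous function supported in `[a, b]` whose Fourier integrals vanish at all nonzero
frequencies is zero. -/
theorem eq_zero_of_integral_mul_exp_eq_zero {a b : ℝ} (hab : a ≤ b) {G : ℝ → ℂ}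
    (hG : ContinuousOn G (Icc a b)) (ha : G a = 0) (hb : G b = 0)
    (h : ∀ ρ : ℝ, ρ ≠ 0 → ∫ t in a..b, G t * Complex.exp (Complex.I * ρ * t) = 0) :
    ∀ t ∈ Icc a b, G t = 0 := by
  -- Clamping the argument extends `G` by its end values, which are zero, to a continuous function
  -- on the line.
  set E : ℝ → ℂ := fun t => G (max a (min t b)) with hE
  have hEG : EqOn E G (Icc a b) := fun t ht => by simp [hE, ht.1, ht.2]
  have hE0 : ∀ t, t ∉ Ioc a b → E t = 0 := by
    intro t ht
    rw [mem_Ioc, not_and_or, not_lt, not_le] at ht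
    rcases ht with ht | ht
    · simp [hE, ha, (min_le_left t b).trans ht]
    · simp [hE, hb, ht.le, hab]
  have hEc : Continuous E := hG.comp_continuous (by fun_prop) fun t =>
    ⟨le_max_left _ _, max_le hab (min_le_right _ _)⟩
  have hEi : Integrable E := hEc.integrable_of_hasCompactSupport
    (HasCompactSupport.of_support_subset_isCompact isCompact_Icc fun t ht => by
      by_contra h0
      exact ht (hE0 t fun h1 => h0 (Ioc_subset_Icc_self h1)))
  have hF : ∀ ξ : ℝ, ξ ≠ 0 → FourierTransform.fourier E ξ = 0 := by
    intro ξ hξ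
    rw [Real.fourier_real_eq_integral_exp_smul, ← setIntegral_eq_integral_of_forall_compl_eq_zero
      (s := Ioc a b) (fun t ht => by simp [hE0 t ht]), ← intervalIntegral.integral_of_le hab,
      -- The Fourier transform is normalised with `e^{-2πiξt}`.
      ← h (-2 * Real.pi * ξ) (by simp [hξ, Real.pi_ne_zero])]
    refine intervalIntegral.integral_congr fun t ht => ?_
    rw [uIcc_of_le hab] at ht
    simp only [hEG ht, smul_eq_mul]
    rw [mul_comm]
    congr 2
    push_cast
    ring
  have hFae : FourierTransform.fourier E =ᵐ[volume] fun _ => (0 : ℂ) := by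
    have : ∀ᵐ ξ : ℝ, ξ ≠ 0 := by simp [ae_iff, measure_singleton]
    filter_upwards [this] with ξ hξ using hF ξ hξ
  have hinv := hEc.fourierInv_fourier_eq hEi ((integrable_zero _ _ _).congr hFae.symm)
  intro t ht
  rw [← hEG ht, ← congrFun hinv t, Real.fourierInv_eq']
  refine integral_eq_zero_of_ae ?_
  filter_upwards [hFae] with ξ hξ
  simp [hξ]

theorem isPrimitiveOn_exp (a b : ℝ) (ρ : ℂ) :
    IsPrimitiveOn a b (fun t => Complex.exp (Complex.I * ρ * t))
      (fun t => Complex.I * ρ * Complex.exp (Complex.I * ρ * t)) := by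
  refine .of_hasDerivAt (fun x => ?_) (by fun_prop)
  have h1 : HasDerivAt (fun t : ℝ => Complex.I * ρ * (t : ℂ)) (Complex.I * ρ) x := by
    simpa using (Complex.ofRealCLM.hasDerivAt (x := x)).const_mul (Complex.I * ρ)
  simpa [mul_comm] using h1.cexp

/-- An integrable function on `(a, b)` whose Fourier integrals vanish at all nonzero frequencies is
zero almost everywhere. -/
theorem ae_eq_zero_of_integral_mul_exp_eq_zero {a b : ℝ} (hab : a ≤ b) {g : ℝ → ℂ}
    (hg : IntervalIntegrable g volume a b)
    (h : ∀ ρ : ℝ, ρ ≠ 0 → ∫ t in a..b, g t * Complex.exp (Complex.I * ρ * t) = 0) :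
    ∀ᵐ t, t ∈ Ioo a b → g t = 0 := by
  -- Passing to the primitive reduces to the continuous case. Its value at `b` is the transform at
  -- frequency zero, obtained by continuity in `ρ`.
  have hP : IsPrimitiveOn a b (fun x => ∫ t in a..x, g t) g := ⟨hg, by simp⟩
  have hcont : Continuous fun ρ : ℝ => ∫ t in a..b, g t * Complex.exp (Complex.I * ρ * t) := by
    refine intervalIntegral.continuous_of_dominated_interval (bound := fun t => ‖g t‖) ?_ ?_
      hg.norm (.of_forall fun t _ => by fun_prop)
    · intro ρ
      exact hg.aestronglyMeasurable_restrict_uIoc.mul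
        (Continuous.aestronglyMeasurable (by fun_prop))
    · intro ρ
      refine .of_forall fun t _ => ?_
      rw [norm_mul, Complex.norm_exp]
      simp
  have h0 : ∫ t in a..b, g t = 0 := by
    have := congrFun (Continuous.ext_on (dense_compl_singleton (0 : ℝ)) hcont continuous_const
      fun ρ hρ => h ρ hρ) 0
    simpa using this
  refine hP.ae_eq_zero fun t ht => eq_zero_of_integral_mul_exp_eq_zero hab (hP.continuousOn hab)
    (by simp) h0 (fun ρ hρ => ?_) t (Ioo_subset_Icc_self ht)
  have h1 := hP.integral_mul_eq hab (isPrimitiveOn_exp a b ρ)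
  simp only [intervalIntegral.integral_same, h0, zero_mul, sub_self, h ρ hρ] at h1
  have h2 : Complex.I * (ρ : ℂ) * ∫ t in a..b,
      (∫ s in a..t, g s) * Complex.exp (Complex.I * ρ * t) = 0 := by
    rw [← intervalIntegral.integral_const_mul, ← h1]
    refine intervalIntegral.integral_congr fun t _ => ?_
    ring
  simpa [hρ] using h2

/-! ### Relation between the kernels on a slice -/

/-- The primitive of `k / c` that vanishes at the left end point is the kernel of the representation
with a factor `iρ`. -/
theorem integral_primitive_mul_exp {x : ℝ} (hx : 0 ≤ x) {c : ℂ} {k H : ℝ → ℂ}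
    (hH : IsPrimitiveOn (-x) x H fun t => 1 / c * k t) (hl : H (-x) = 0) (hr : H x = 1 - 1 / c)
    (ρ : ℂ) :
    Complex.exp (Complex.I * ρ * x) -
        Complex.I * ρ * ∫ t in (-x)..x, H t * Complex.exp (Complex.I * ρ * t)
      = 1 / c * (Complex.exp (Complex.I * ρ * x) +
        ∫ t in (-x)..x, k t * Complex.exp (Complex.I * ρ * t)) := by
  have h1 := hH.integral_mul_eq (by linarith) (isPrimitiveOn_exp (-x) x ρ)
  have h2 : ∫ t in (-x)..x, H t * (Complex.I * ρ * Complex.exp (Complex.I * ρ * t))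
      = Complex.I * ρ * ∫ t in (-x)..x, H t * Complex.exp (Complex.I * ρ * t) := by
    rw [← intervalIntegral.integral_const_mul]
    refine intervalIntegral.integral_congr fun t _ => ?_
    ring
  have h3 : ∫ t in (-x)..x, 1 / c * k t * Complex.exp (Complex.I * ρ * t)
      = 1 / c * ∫ t in (-x)..x, k t * Complex.exp (Complex.I * ρ * t) := by
    rw [← intervalIntegral.integral_const_mul]
    refine intervalIntegral.integral_congr fun t _ => ?_
    ring
  rw [← h2, h1, hl, hr, h3]
  ring

/-- If `k` and `kh` represent proportional families of functions, then `kh` is the primitive of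
`k / c` that vanishes at the left end point. -/
theorem exists_primitive_ae_eq {x : ℝ} (hx : 0 ≤ x) {c : ℂ} (hc : c ≠ 0) {k kh : ℝ → ℂ}
    (hk : IntervalIntegrable k volume (-x) x) (hkh : IntervalIntegrable kh volume (-x) x)
    (h : ∀ ρ : ℂ, Complex.exp (Complex.I * ρ * x) +
        ∫ t in (-x)..x, k t * Complex.exp (Complex.I * ρ * t)
      = c * (Complex.exp (Complex.I * ρ * x) -
        Complex.I * ρ * ∫ t in (-x)..x, kh t * Complex.exp (Complex.I * ρ * t))) :
    ∃ H : ℝ → ℂ, IsPrimitiveOn (-x) x H (fun t => 1 / c * k t) ∧ H (-x) = 0 ∧ H x = 1 - 1 / c ∧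
      ∀ᵐ t, t ∈ Ioo (-x) x → H t = kh t := by
  have hxx : -x ≤ x := by linarith
  have hH : IsPrimitiveOn (-x) x (fun t => ∫ s in (-x)..t, 1 / c * k s) (fun t => 1 / c * k t) :=
    ⟨hk.const_mul _, by simp⟩
  have hHc := hH.continuousOn hxx
  rw [← uIcc_of_le hxx] at hHc
  -- At `ρ = 0` the hypothesis reads `1 + ∫ k = c`.
  have hr : ∫ s in (-x)..x, 1 / c * k s = 1 - 1 / c := by
    have := h 0
    simp only [mul_zero, zero_mul, Complex.exp_zero, mul_one, sub_zero] at this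
    rw [intervalIntegral.integral_const_mul, eq_sub_of_add_eq' this]
    field_simp
  refine ⟨_, hH, by simp, hr, ?_⟩
  have key := ae_eq_zero_of_integral_mul_exp_eq_zero hxx (hHc.intervalIntegrable.sub hkh)
    fun ρ hρ => ?_
  · filter_upwards [key] with t ht htx
    exact sub_eq_zero.1 (ht htx)
  · have hec : ContinuousOn (fun t : ℝ => Complex.exp (Complex.I * ρ * t)) (uIcc (-x) x) := by
      fun_prop
    have h1 := integral_primitive_mul_exp hx hH (by simp) hr ρ
    rw [h ρ, ← mul_assoc, one_div_mul_cancel hc, one_mul] at h1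
    have h2 : Complex.I * (ρ : ℂ) ≠ 0 := by simp [hρ]
    simp only [sub_mul]
    rw [intervalIntegral.integral_sub (hHc.intervalIntegrable.mul_continuousOn hec)
      (hkh.mul_continuousOn hec)]
    refine mul_left_cancel₀ h2 ?_
    linear_combination -h1

/-- The intertwining relation on a slice. -/
theorem sub_integral_primitive_mul {x : ℝ} (hx : 0 ≤ x) {c : ℂ} {k kh H v v' : ℝ → ℂ}
    (hH : IsPrimitiveOn (-x) x H fun t => 1 / c * k t) (hl : H (-x) = 0) (hr : H x = 1 - 1 / c)
    (hae : ∀ᵐ t, t ∈ Ioo (-x) x → H t = kh t) (hv : IsPrimitiveOn (-x) x v v') :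
    v x - ∫ t in (-x)..x, kh t * v' t = 1 / c * (v x + ∫ t in (-x)..x, k t * v t) := by
  have hxx : -x ≤ x := by linarith
  have h0 : ∫ t in (-x)..x, kh t * v' t = ∫ t in (-x)..x, H t * v' t := by
    rw [← integral_Ioo_eq_intervalIntegral hxx, ← integral_Ioo_eq_intervalIntegral hxx]
    refine integral_congr_ae ((ae_restrict_iff' measurableSet_Ioo).2 ?_)
    filter_upwards [hae] with t ht htx
    rw [ht htx]
  have h3 : ∫ t in (-x)..x, 1 / c * k t * v t = 1 / c * ∫ t in (-x)..x, k t * v t := by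
    rw [← intervalIntegral.integral_const_mul]
    refine intervalIntegral.integral_congr fun t _ => ?_
    ring
  -- The boundary term `(1 - 1/c) v(x)` turns `v(x)` into `v(x)/c`.
  rw [h0, hH.integral_mul_eq hxx hv, h3, hl, hr]
  ring

/-! ### Uniqueness of slices and comparison of the two kernels -/

section Kernels

variable {ℓ : ℝ} {f f' : ℝ → ℂ}

theorem IsSchrodingerSystem.eqOn (hℓ : 0 < ℓ) (hf : HasW12Deriv 0 ℓ f f')
    (hfc : ContinuousOn f (Icc 0 ℓ)) (hf_ne : ∀ x ∈ Icc 0 ℓ, f x ≠ 0) (hf_zero : f 0 = 1)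
    {ρ : ℂ} {y₁ w₁ y₂ w₂ : ℝ → ℂ}
    (h₁ : IsSchrodingerSystem ℓ f f' ρ y₁ w₁) (h₂ : IsSchrodingerSystem ℓ f f' ρ y₂ w₂) :
    EqOn y₁ y₂ (Icc 0 ℓ) := fun x hx => by
  have h := (h₁.isImpedanceSystem hℓ hf hfc hf_ne hf_zero).unique hℓ.le hfc hf_ne
    (h₂.isImpedanceSystem hℓ hf hfc hf_ne hf_zero) hx
  exact (div_left_inj' (hf_ne x hx)).1 h

/-- This identifies `1 + ∫ K(x,t) dt` with `f x`, and so gives the end value of the primitive of a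
Schrödinger kernel. -/
theorem isSchrodingerSystem_zero (hℓ : 0 < ℓ) (hf : HasW12Deriv 0 ℓ f f')
    (hfc : ContinuousOn f (Icc 0 ℓ)) (hf_ne : ∀ x ∈ Icc 0 ℓ, f x ≠ 0) (hf_zero : f 0 = 1) :
    IsSchrodingerSystem ℓ f f' 0 f (fun _ => 0) := by
  refine ⟨(hf.isPrimitiveOn hℓ hfc).congr_deriv hℓ.le (.of_forall fun x hx => ?_),
    ⟨by simp, by simp⟩, hf_zero, by simp⟩
  rw [div_mul_cancel₀ _ (hf_ne x (Ioo_subset_Icc_self hx)), add_zero]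

/-- Slices of kernels with the same transforms agree almost everywhere. -/
theorem IsSchrodingerKernel.ae_unique (hℓ : 0 < ℓ) (hf : HasW12Deriv 0 ℓ f f')
    (hfc : ContinuousOn f (Icc 0 ℓ)) (hf_ne : ∀ x ∈ Icc 0 ℓ, f x ≠ 0) (hf_zero : f 0 = 1)
    {K₁ K₂ : ℝ → ℝ → ℂ} (h₁ : IsSchrodingerKernel ℓ f f' K₁) (h₂ : IsSchrodingerKernel ℓ f f' K₂)
    {x : ℝ} (hx : x ∈ Ioc 0 ℓ) : ∀ᵐ t, t ∈ Ioo (-x) x → K₁ x t = K₂ x t := by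
  have hxx : -x ≤ x := by linarith [hx.1]
  have key := ae_eq_zero_of_integral_mul_exp_eq_zero hxx ((h₁.1.2 x hx).sub (h₂.1.2 x hx))
    fun ρ hρ => ?_
  · filter_upwards [key] with t ht htx
    exact sub_eq_zero.1 (ht htx)
  · have hec : ContinuousOn (fun t : ℝ => Complex.exp (Complex.I * ρ * t)) (uIcc (-x) x) := by
      fun_prop
    obtain ⟨e₁, he₁, h₁'⟩ := h₁.2 ρ
    obtain ⟨e₂, he₂, h₂'⟩ := h₂.2 ρ
    obtain ⟨w₁, hw₁⟩ := he₁.exists_isSchrodingerSystem hℓ hf hfc hf_ne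
    obtain ⟨w₂, hw₂⟩ := he₂.exists_isSchrodingerSystem hℓ hf hfc hf_ne
    have h := hw₁.eqOn hℓ hf hfc hf_ne hf_zero hw₂ (Ioc_subset_Icc_self hx)
    rw [h₁' x hx, h₂' x hx] at h
    simp only [sub_mul]
    rw [intervalIntegral.integral_sub ((h₁.1.2 x hx).mul_continuousOn hec)
      ((h₂.1.2 x hx).mul_continuousOn hec), add_left_cancel h, sub_self]

theorem exists_primitive_of_kernels (hℓ : 0 < ℓ) (hf : HasW12Deriv 0 ℓ f f')
    (hfc : ContinuousOn f (Icc 0 ℓ)) (hf_ne : ∀ x ∈ Icc 0 ℓ, f x ≠ 0) (hf_zero : f 0 = 1)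
    {K Kh : ℝ → ℝ → ℂ} (hK : IsSchrodingerKernel ℓ f f' K) (hKh : IsImpedanceKernel ℓ f Kh)
    {x : ℝ} (hx : x ∈ Ioc 0 ℓ) :
    ∃ H : ℝ → ℂ, IsPrimitiveOn (-x) x H (fun t => 1 / f x * K x t) ∧ H (-x) = 0 ∧
      H x = 1 - 1 / f x ∧ ∀ᵐ t, t ∈ Ioo (-x) x → H t = Kh x t := by
  refine exists_primitive_ae_eq hx.1.le (hf_ne x (Ioc_subset_Icc_self hx)) (hK.1.2 x hx)
    (hKh.1.2 x hx) fun ρ => ?_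
  obtain ⟨e, he, h⟩ := hK.2 ρ
  obtain ⟨eh, heh, h'⟩ := hKh.2 ρ
  rw [← h x hx, ← h' x hx, he.eq_mul hℓ hf hfc hf_ne hf_zero heh (Ioc_subset_Icc_self hx)]

end Kernels

/-! ### The triangle -/

theorem isClosed_triangle (ℓ : ℝ) : IsClosed (triangle ℓ) := by
  have h1 : IsClosed {p : ℝ × ℝ | 0 ≤ p.1} := isClosed_le continuous_const continuous_fst
  have h2 : IsClosed {p : ℝ × ℝ | p.1 ≤ ℓ} := isClosed_le continuous_fst continuous_const
  have h3 : IsClosed {p : ℝ × ℝ | |p.2| ≤ p.1} :=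
    isClosed_le continuous_snd.abs continuous_fst
  exact h1.inter (h2.inter h3)

theorem isCompact_triangle (ℓ : ℝ) : IsCompact (triangle ℓ) := by
  refine (isCompact_Icc (a := (0, -ℓ)) (b := ((ℓ, ℓ) : ℝ × ℝ))).of_isClosed_subset
    (isClosed_triangle ℓ) fun p hp => ?_
  have := abs_le.1 (hp.2.2.trans hp.2.1)
  exact ⟨⟨hp.1, this.1⟩, ⟨hp.2.1, this.2⟩⟩

/-- A measurable function on the triangle vanishes almost everywhere if its slices do. -/
theorem ae_triangle_eq_zero {ℓ : ℝ} {D : ℝ × ℝ → ℂ}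
    (hD : AEStronglyMeasurable D (volume.restrict (triangle ℓ)))
    (h : ∀ x ∈ Ioc 0 ℓ, ∀ᵐ t, t ∈ Ioo (-x) x → D (x, t) = 0) :
    ∀ᵐ p ∂volume.restrict (triangle ℓ), D p = 0 := by
  have hT := (isClosed_triangle ℓ).measurableSet
  set E := (triangle ℓ).indicator D with hE
  have hEm : AEStronglyMeasurable E (volume : Measure (ℝ × ℝ)) :=
    (aestronglyMeasurable_indicator_iff hT).2 hD
  have hE0 : ∀ᵐ x : ℝ, ∀ᵐ t : ℝ, E (x, t) = 0 := by
    have hx0 : ∀ᵐ x : ℝ, x ≠ 0 := by simp [ae_iff, measure_singleton]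
    filter_upwards [hx0] with x hx0
    by_cases hx : x ∈ Ioc 0 ℓ
    · have h1 : ∀ᵐ t : ℝ, t ≠ x := by simp [ae_iff, measure_singleton]
      have h2 : ∀ᵐ t : ℝ, t ≠ -x := by simp [ae_iff, measure_singleton]
      filter_upwards [h x hx, h1, h2] with t ht h1 h2
      by_cases hp : (x, t) ∈ triangle ℓ
      · have := abs_le.1 hp.2.2
        rw [hE, indicator_of_mem hp]
        exact ht ⟨lt_of_le_of_ne this.1 (Ne.symm h2), lt_of_le_of_ne this.2 h1⟩
      · exact indicator_of_notMem hp _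
    · refine .of_forall fun t => indicator_of_notMem (fun hp => hx ⟨?_, hp.2.1⟩) _
      exact lt_of_le_of_ne hp.1 (Ne.symm hx0)
  -- The slice criterion for null sets needs a measurable set, hence a strongly measurable
  -- representative.
  obtain ⟨F, hF, hEF⟩ := hEm
  have hFz : ∀ᵐ p : ℝ × ℝ, F p = 0 := by
    have hm : MeasurableSet {p | F p ≠ 0} := hF.measurable (measurableSet_singleton 0).compl
    rw [ae_iff, Measure.volume_eq_prod, Measure.measure_prod_null hm]
    rw [Measure.volume_eq_prod] at hEF
    filter_upwards [hE0, Measure.ae_ae_of_ae_prod hEF] with x h1 h2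
    have h3 : ∀ᵐ t : ℝ, F (x, t) = 0 := by
      filter_upwards [h1, h2] with t h1 h2
      rw [← h2, h1]
    exact ae_iff.1 h3
  rw [ae_restrict_iff' hT]
  filter_upwards [hEF, hFz] with p h1 h2 hp
  rw [← indicator_of_mem hp D, ← hE, h1, h2]

/-! ### Volterra operators on kernels -/

/-- The operator `g ↦ ∫₀ˣ σ(s) g(s, t + ε (x - s)) ds`. -/
def volterra (σ : ℝ → ℂ) (ε : ℝ) (g : ℝ → ℝ → ℂ) (x t : ℝ) : ℂ :=
  ∫ s in Ioc 0 x, σ s * g s (t + ε * (x - s))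

/-- A measurable kernel supported in `|t| ≤ x` and bounded by `C exp (lam x)`. -/
structure IsBoundedKernel (lam C : ℝ) (g : ℝ → ℝ → ℂ) : Prop where
  measurable : StronglyMeasurable (Function.uncurry g)
  bound : ∀ x t, ‖g x t‖ ≤ C * Real.exp (lam * x)
  support : ∀ x t, x < |t| → g x t = 0

theorem stronglyMeasurable_volterra {σ : ℝ → ℂ} (hσ : StronglyMeasurable σ) (ε : ℝ)
    {g : ℝ → ℝ → ℂ} (hg : StronglyMeasurable (Function.uncurry g)) :
    StronglyMeasurable (Function.uncurry (volterra σ ε g)) := by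
  have h : Function.uncurry (volterra σ ε g) = fun p : ℝ × ℝ =>
      ∫ s, (Ioc 0 p.1).indicator (fun s => σ s * g s (p.2 + ε * (p.1 - s))) s := by
    funext p
    rw [integral_indicator measurableSet_Ioc]
    rfl
  rw [h]
  refine StronglyMeasurable.integral_prod_right
    (f := fun (p : ℝ × ℝ) s => (Ioc 0 p.1).indicator (fun s => σ s * g s (p.2 + ε * (p.1 - s))) s)
    ?_
  have hS₁ : MeasurableSet {q : (ℝ × ℝ) × ℝ | 0 < q.2} :=
    measurableSet_lt (by fun_prop) (by fun_prop)
  have hS₂ : MeasurableSet {q : (ℝ × ℝ) × ℝ | q.2 ≤ q.1.1} :=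
    measurableSet_le (by fun_prop) (by fun_prop)
  have h1 : StronglyMeasurable fun q : (ℝ × ℝ) × ℝ => σ q.2 := hσ.comp_measurable measurable_snd
  have h2 := hg.comp_measurable
    (g := fun q : (ℝ × ℝ) × ℝ => (q.2, q.1.2 + ε * (q.1.1 - q.2))) (by fun_prop)
  exact (h1.mul h2).indicator (hS₁.inter hS₂)

/-- Unit propagation speed: if `|t| > x` then `|t + ε (x - s)| ≥ |t| - (x - s) > s`. -/
theorem volterra_eq_zero (σ : ℝ → ℂ) {ε : ℝ} (hε : |ε| = 1) {g : ℝ → ℝ → ℂ}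
    (hg : ∀ x t, x < |t| → g x t = 0) (x t : ℝ) (hxt : x < |t|) : volterra σ ε g x t = 0 := by
  refine setIntegral_eq_zero_of_forall_eq_zero fun s hs => ?_
  rw [hg, mul_zero]
  have h1 : |ε * (x - s)| = x - s := by
    rw [abs_mul, hε, one_mul, abs_of_nonneg (by linarith [hs.2])]
  have h2 : |t| ≤ |t + ε * (x - s)| + |ε * (x - s)| := by
    simpa using abs_sub (t + ε * (x - s)) (ε * (x - s))
  linarith

section

variable {σ : ℝ → ℂ}

/-- In the sup norm weighted by `exp (lam x)` this makes the Volterra operators contract by `1/2`.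
The product `‖σ‖ exp (lam s)` is split by the weighted inequality between arithmetic and geometric
means. -/
theorem exists_weight (hσ : MemLp σ 2) : ∃ lam : ℝ, 0 ≤ lam ∧ ∀ x : ℝ,
    ∫ s in Ioc 0 x, ‖σ s‖ * Real.exp (lam * s) ≤ 1 / 2 * Real.exp (lam * x) := by
  set N := ∫ s, ‖σ s‖ ^ 2 with hN
  have hN0 : 0 ≤ N := integral_nonneg fun _ => by positivity
  have hi : Integrable fun s => ‖σ s‖ ^ 2 := (memLp_two_iff_integrable_sq_norm hσ.1).1 hσ
  -- With this value each of the two parts contributes at most `exp (lam x) / 4`; `N + 1` in place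
  -- of `N` keeps it positive when `σ = 0`.
  refine ⟨2 * (N + 1), by positivity, fun x => ?_⟩
  rcases le_or_gt x 0 with hx | hx
  · rw [Ioc_eq_empty (by linarith)]
    simp only [Measure.restrict_empty, integral_zero_measure]
    positivity
  set lam := 2 * (N + 1) with hlam
  have hlam0 : 0 < lam := by positivity
  have i1 : Integrable (fun s => Real.exp (lam * x) / (4 * (N + 1)) * ‖σ s‖ ^ 2)
      (volume.restrict (Ioc 0 x)) := (hi.const_mul _).restrict
  have i2 : Integrable (fun s => (N + 1) * Real.exp (-(lam * x)) * Real.exp (2 * lam * s))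
      (volume.restrict (Ioc 0 x)) :=
    (Continuous.integrableOn_Ioc (by fun_prop) : IntegrableOn _ _ _)
  have h1 : ∫ s in Ioc 0 x, ‖σ s‖ * Real.exp (lam * s) ≤ ∫ s in Ioc 0 x,
      (Real.exp (lam * x) / (4 * (N + 1)) * ‖σ s‖ ^ 2
        + (N + 1) * Real.exp (-(lam * x)) * Real.exp (2 * lam * s)) := by
    refine integral_mono_of_nonneg (.of_forall fun s => by positivity) (i1.add i2)
      (.of_forall fun s => ?_)
    have e1 : Real.exp (2 * lam * s) = Real.exp (lam * s) ^ 2 := by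
      rw [← Real.exp_nat_mul]
      congr 1
      push_cast
      ring
    have e2 : Real.exp (lam * x) * Real.exp (-(lam * x)) = 1 := by
      rw [← Real.exp_add, add_neg_cancel, Real.exp_zero]
    simp only [e1]
    have e3 : Real.exp (lam * x) / (4 * (N + 1)) * ‖σ s‖ ^ 2
        + (N + 1) * Real.exp (-(lam * x)) * Real.exp (lam * s) ^ 2 - ‖σ s‖ * Real.exp (lam * s)
        = Real.exp (lam * x) * (N + 1) *
          (‖σ s‖ / (2 * (N + 1)) - Real.exp (-(lam * x)) * Real.exp (lam * s)) ^ 2 := by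
      have hn : N + 1 ≠ 0 := by positivity
      rw [Real.exp_neg]
      field_simp
      ring
    have e4 : 0 ≤ Real.exp (lam * x) * (N + 1) *
          (‖σ s‖ / (2 * (N + 1)) - Real.exp (-(lam * x)) * Real.exp (lam * s)) ^ 2 := by
      positivity
    linarith
  refine h1.trans ?_
  rw [integral_add i1 i2, integral_const_mul, integral_const_mul]
  have h2 : ∫ s in Ioc 0 x, ‖σ s‖ ^ 2 ≤ N :=
    setIntegral_le_integral hi (.of_forall fun _ => by positivity)
  have h3 : ∫ s in Ioc 0 x, Real.exp (2 * lam * s) ≤ Real.exp (lam * x) ^ 2 / (2 * lam) := by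
    rw [← intervalIntegral.integral_of_le hx.le,
      intervalIntegral.integral_comp_mul_left (fun s => Real.exp s) (by positivity), integral_exp,
      smul_eq_mul, ← Real.exp_nat_mul, inv_mul_eq_div]
    refine div_le_div_of_nonneg_right ?_ (by positivity)
    simp only [mul_zero, Real.exp_zero, Nat.cast_ofNat, ← mul_assoc]
    linarith
  have h4 : Real.exp (lam * x) / (4 * (N + 1)) * ∫ s in Ioc 0 x, ‖σ s‖ ^ 2
      ≤ 1 / 4 * Real.exp (lam * x) := by
    refine (mul_le_mul_of_nonneg_left (h2.trans (by linarith : N ≤ N + 1)) (by positivity)).trans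
      (le_of_eq ?_)
    field_simp
  have h5 : (N + 1) * Real.exp (-(lam * x)) * ∫ s in Ioc 0 x, Real.exp (2 * lam * s)
      ≤ 1 / 4 * Real.exp (lam * x) := by
    refine (mul_le_mul_of_nonneg_left h3 (by positivity)).trans (le_of_eq ?_)
    rw [Real.exp_neg, hlam]
    field_simp
    norm_num
  linarith

theorem integrableOn_norm_mul_exp (hσ : MemLp σ 2) (lam x : ℝ) :
    IntegrableOn (fun s => ‖σ s‖ * Real.exp (lam * s)) (Ioc 0 x) := by
  have h1 : IntegrableOn (fun s => ‖σ s‖) (Ioc 0 x) :=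
    (hσ.restrict (Ioc 0 x)).norm.integrable (by norm_num)
  exact h1.mul_continuousOn_of_subset (K := Icc 0 x) (by fun_prop) measurableSet_Ioc
    isCompact_Icc Ioc_subset_Icc_self

variable {lam C : ℝ} {g : ℝ → ℝ → ℂ}

theorem IsBoundedKernel.integrableOn (hσm : StronglyMeasurable σ) (hσ : MemLp σ 2)
    (hg : IsBoundedKernel lam C g) (ε x t : ℝ) :
    IntegrableOn (fun s => σ s * g s (t + ε * (x - s))) (Ioc 0 x) := by
  have hm : StronglyMeasurable fun s => σ s * g s (t + ε * (x - s)) :=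
    hσm.mul (hg.measurable.comp_measurable (g := fun s => (s, t + ε * (x - s))) (by fun_prop))
  refine Integrable.mono' ((integrableOn_norm_mul_exp hσ lam x).const_mul C)
    hm.aestronglyMeasurable (.of_forall fun s => ?_)
  rw [norm_mul]
  calc ‖σ s‖ * ‖g s (t + ε * (x - s))‖ ≤ ‖σ s‖ * (C * Real.exp (lam * s)) :=
        mul_le_mul_of_nonneg_left (hg.bound _ _) (norm_nonneg _)
    _ = C * (‖σ s‖ * Real.exp (lam * s)) := by ring

theorem IsBoundedKernel.nonneg (hg : IsBoundedKernel lam C g) : 0 ≤ C := by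
  simpa using (norm_nonneg _).trans (hg.bound 0 0)

theorem IsBoundedKernel.integral_norm_le (hσ : MemLp σ 2)
    (hlam : ∀ x : ℝ, ∫ s in Ioc 0 x, ‖σ s‖ * Real.exp (lam * s) ≤ 1 / 2 * Real.exp (lam * x))
    (hg : IsBoundedKernel lam C g) (ε x t : ℝ) :
    ∫ s in Ioc 0 x, ‖σ s * g s (t + ε * (x - s))‖ ≤ C / 2 * Real.exp (lam * x) := by
  have h1 : ∫ s in Ioc 0 x, ‖σ s * g s (t + ε * (x - s))‖
      ≤ ∫ s in Ioc 0 x, C * (‖σ s‖ * Real.exp (lam * s)) := by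
    refine integral_mono_of_nonneg (.of_forall fun s => norm_nonneg _)
      ((integrableOn_norm_mul_exp hσ lam x).const_mul C) (.of_forall fun s => ?_)
    simp only [norm_mul]
    calc ‖σ s‖ * ‖g s (t + ε * (x - s))‖ ≤ ‖σ s‖ * (C * Real.exp (lam * s)) :=
          mul_le_mul_of_nonneg_left (hg.bound _ _) (norm_nonneg _)
      _ = C * (‖σ s‖ * Real.exp (lam * s)) := by ring
  refine h1.trans ?_
  rw [integral_const_mul]
  calc C * ∫ s in Ioc 0 x, ‖σ s‖ * Real.exp (lam * s) ≤ C * (1 / 2 * Real.exp (lam * x)) :=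
        mul_le_mul_of_nonneg_left (hlam x) hg.nonneg
    _ = C / 2 * Real.exp (lam * x) := by ring

theorem IsBoundedKernel.volterra (hσm : StronglyMeasurable σ) (hσ : MemLp σ 2)
    (hlam : ∀ x : ℝ, ∫ s in Ioc 0 x, ‖σ s‖ * Real.exp (lam * s) ≤ 1 / 2 * Real.exp (lam * x))
    {ε : ℝ} (hε : |ε| = 1) (hg : IsBoundedKernel lam C g) :
    IsBoundedKernel lam (C / 2) (volterra σ ε g) :=
  ⟨stronglyMeasurable_volterra hσm ε hg.measurable,
    fun x t => (norm_integral_le_integral_norm _).trans (hg.integral_norm_le hσ hlam ε x t),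
    volterra_eq_zero σ hε hg.support⟩

theorem IsBoundedKernel.summable {c : ℕ → ℝ} {G : ℕ → ℝ → ℝ → ℂ}
    (hG : ∀ n, IsBoundedKernel lam (c n) (G n)) (hc : Summable c) (x t : ℝ) :
    Summable fun n => G n x t :=
  Summable.of_norm_bounded (hc.mul_right _) fun n => (hG n).bound x t

theorem IsBoundedKernel.tsum {c : ℕ → ℝ} {G : ℕ → ℝ → ℝ → ℂ}
    (hG : ∀ n, IsBoundedKernel lam (c n) (G n)) (hc : Summable c) :
    IsBoundedKernel lam (∑' n, c n) fun x t => ∑' n, G n x t := by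
  refine ⟨?_, fun x t => ?_, fun x t hxt => ?_⟩
  · refine stronglyMeasurable_of_tendsto (f := fun n => Function.uncurry fun x t =>
      ∑ i ∈ Finset.range n, G i x t) Filter.atTop (fun n => ?_) ?_
    · exact Finset.stronglyMeasurable_fun_sum (f := fun i => Function.uncurry (G i))
        (Finset.range n) fun i _ => (hG i).measurable
    · rw [tendsto_pi_nhds]
      exact fun p => (IsBoundedKernel.summable hG hc p.1 p.2).hasSum.tendsto_sum_nat
  · rw [← tsum_mul_right]
    exact tsum_of_norm_bounded (hc.mul_right _).hasSum fun n => (hG n).bound x t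
  · simp [fun n => (hG n).support x t hxt]

/-- Sum and integral commute because the `L¹` norms of the integrands are summable. -/
theorem volterra_tsum (hσm : StronglyMeasurable σ) (hσ : MemLp σ 2)
    (hlam : ∀ x : ℝ, ∫ s in Ioc 0 x, ‖σ s‖ * Real.exp (lam * s) ≤ 1 / 2 * Real.exp (lam * x))
    {c : ℕ → ℝ} {G : ℕ → ℝ → ℝ → ℂ} (hG : ∀ n, IsBoundedKernel lam (c n) (G n))
    (hc : Summable c) (ε x t : ℝ) :
    volterra σ ε (fun x t => ∑' n, G n x t) x t = ∑' n, volterra σ ε (G n) x t := by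
  have h := hasSum_integral_of_summable_integral_norm
    (fun n => (hG n).integrableOn hσm hσ ε x t)
    (Summable.of_nonneg_of_le (fun n => integral_nonneg fun _ => norm_nonneg _)
      (fun n => (hG n).integral_norm_le hσ hlam ε x t) ((hc.div_const 2).mul_right _))
  refine Eq.trans (integral_congr_ae (.of_forall fun s => ?_)) h.tsum_eq.symm
  simp only
  rw [tsum_mul_left]

/-- The term of order one in the expansion of the kernel. -/
def firstKernel (σ : ℝ → ℂ) (x t : ℝ) : ℂ := if |t| ≤ x then 1 / 2 * σ ((x + t) / 2) else 0

theorem stronglyMeasurable_firstKernel (hσm : StronglyMeasurable σ) :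
    StronglyMeasurable (Function.uncurry (firstKernel σ)) := by
  have h1 : MeasurableSet {p : ℝ × ℝ | |p.2| ≤ p.1} :=
    (isClosed_le continuous_snd.abs continuous_fst).measurableSet
  exact StronglyMeasurable.ite h1
    ((hσm.comp_measurable (g := fun p : ℝ × ℝ => (p.1 + p.2) / 2) (by fun_prop)).const_mul (1 / 2))
    stronglyMeasurable_const

theorem norm_firstKernel_le (σ : ℝ → ℂ) (x t : ℝ) :
    ‖firstKernel σ x t‖ ≤ 1 / 2 * ‖σ ((x + t) / 2)‖ := by
  rw [firstKernel]
  split_ifs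
  · rw [norm_mul]
    norm_num
  · simp

theorem firstKernel_support (σ : ℝ → ℂ) (x t : ℝ) (h : x < |t|) : firstKernel σ x t = 0 :=
  if_neg h.not_ge

/-- Along the line of integration `firstKernel` samples `σ` at `s + (t - x)/2`, so the product
involves two translates of `σ`. The integral of the resulting bound over the line does not depend on
`x` or `t`. -/
theorem norm_mul_firstKernel_le (σ : ℝ → ℂ) (x t s : ℝ) :
    ‖σ s * firstKernel σ s (t + -1 * (x - s))‖
      ≤ 1 / 4 * ‖σ s‖ ^ 2 + 1 / 4 * ‖σ (s + (t - x) / 2)‖ ^ 2 := by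
  have h := norm_firstKernel_le σ s (t + -1 * (x - s))
  rw [show (s + (t + -1 * (x - s))) / 2 = s + (t - x) / 2 by ring] at h
  rw [norm_mul]
  have h2 := mul_le_mul_of_nonneg_left h (norm_nonneg (σ s))
  nlinarith [sq_nonneg (‖σ s‖ - ‖σ (s + (t - x) / 2)‖)]

theorem integrable_sq_add_sq (hσ : MemLp σ 2) (c : ℝ) :
    Integrable fun s => 1 / 4 * ‖σ s‖ ^ 2 + 1 / 4 * ‖σ (s + c)‖ ^ 2 := by
  have hi : Integrable fun s => ‖σ s‖ ^ 2 := (memLp_two_iff_integrable_sq_norm hσ.1).1 hσ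
  exact (hi.const_mul _).add ((hi.comp_add_right c).const_mul _)

theorem integrableOn_mul_firstKernel (hσm : StronglyMeasurable σ) (hσ : MemLp σ 2) (x t : ℝ) :
    IntegrableOn (fun s => σ s * firstKernel σ s (t + -1 * (x - s))) (Ioc 0 x) := by
  have hm : StronglyMeasurable fun s => σ s * firstKernel σ s (t + -1 * (x - s)) :=
    hσm.mul ((stronglyMeasurable_firstKernel hσm).comp_measurable
      (g := fun s => (s, t + -1 * (x - s))) (by fun_prop))
  exact Integrable.mono' (integrable_sq_add_sq hσ ((t - x) / 2)).restrict
    hm.aestronglyMeasurable (.of_forall fun s => norm_mul_firstKernel_le σ x t s)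

/-- `firstKernel` itself need not be bounded; one integration makes it so, and the Neumann series
can start from there. -/
theorem isBoundedKernel_volterra_firstKernel (hσm : StronglyMeasurable σ) (hσ : MemLp σ 2)
    (hlam0 : 0 ≤ lam) :
    IsBoundedKernel lam (1 / 2 * ∫ s, ‖σ s‖ ^ 2) (volterra σ (-1) (firstKernel σ)) := by
  have hi : Integrable fun s => ‖σ s‖ ^ 2 := (memLp_two_iff_integrable_sq_norm hσ.1).1 hσ
  have hN0 : 0 ≤ ∫ s, ‖σ s‖ ^ 2 := integral_nonneg fun _ => by positivity
  refine ⟨stronglyMeasurable_volterra hσm _ (stronglyMeasurable_firstKernel hσm), fun x t => ?_,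
    volterra_eq_zero σ (by simp) (firstKernel_support σ)⟩
  rcases le_or_gt x 0 with hx | hx
  · rw [volterra, Ioc_eq_empty (by linarith)]
    simp only [Measure.restrict_empty, integral_zero_measure, norm_zero]
    positivity
  · have hsq := integrable_sq_add_sq hσ ((t - x) / 2)
    have h1 : ‖volterra σ (-1) (firstKernel σ) x t‖ ≤ 1 / 2 * ∫ s, ‖σ s‖ ^ 2 :=
      calc ‖volterra σ (-1) (firstKernel σ) x t‖
          ≤ ∫ s in Ioc 0 x, ‖σ s * firstKernel σ s (t + -1 * (x - s))‖ :=
            norm_integral_le_integral_norm _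
        _ ≤ ∫ s in Ioc 0 x, (1 / 4 * ‖σ s‖ ^ 2 + 1 / 4 * ‖σ (s + (t - x) / 2)‖ ^ 2) :=
            integral_mono_of_nonneg (.of_forall fun _ => norm_nonneg _) hsq.restrict
              (.of_forall fun s => norm_mul_firstKernel_le σ x t s)
        _ ≤ ∫ s, (1 / 4 * ‖σ s‖ ^ 2 + 1 / 4 * ‖σ (s + (t - x) / 2)‖ ^ 2) :=
            setIntegral_le_integral hsq (.of_forall fun _ => by positivity)
        _ = 1 / 2 * ∫ s, ‖σ s‖ ^ 2 := by
            rw [integral_add (hi.const_mul _) ((hi.comp_add_right _).const_mul _),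
              integral_const_mul, integral_const_mul,
              integral_add_right_eq_self (fun s => ‖σ s‖ ^ 2)]
            ring
    refine h1.trans (le_mul_of_one_le_right (by positivity) (Real.one_le_exp (by positivity)))

/-- The Volterra equations for the two components of the kernel. -/
theorem exists_kernel_pair (hσm : StronglyMeasurable σ) (hσ : MemLp σ 2) :
    ∃ (lam C : ℝ) (α β : ℝ → ℝ → ℂ), 0 ≤ lam ∧ IsBoundedKernel lam C α ∧ IsBoundedKernel lam C β ∧
      (∀ x t, β x t = volterra σ 1 α x t) ∧
      ∀ x t, α x t = volterra σ (-1) (fun x t => firstKernel σ x t + β x t) x t := by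
  obtain ⟨lam, hlam0, hlam⟩ := exists_weight hσ
  set C₀ := 1 / 2 * ∫ s, ‖σ s‖ ^ 2
  -- Eliminating `β` leaves `α = V₋ k₁ + V₋ V₊ α`, with `k₁` the first kernel; these are the terms
  -- of its Neumann series. Each step applies two operators of norm at most `1/2`, whence the ratio
  -- `1/4`.
  let G : ℕ → ℝ → ℝ → ℂ := fun n =>
    (fun g => volterra σ (-1) (volterra σ 1 g))^[n] (volterra σ (-1) (firstKernel σ))
  have hGs : ∀ n, G (n + 1) = volterra σ (-1) (volterra σ 1 (G n)) := fun n =>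
    Function.iterate_succ_apply' _ _ _
  have hG : ∀ n, IsBoundedKernel lam (C₀ * (1 / 4) ^ n) (G n) := by
    intro n
    induction n with
    | zero =>
      rw [pow_zero, mul_one]
      exact isBoundedKernel_volterra_firstKernel hσm hσ hlam0
    | succ n ih =>
      rw [hGs]
      convert (ih.volterra hσm hσ hlam (ε := 1) (by simp)).volterra hσm hσ hlam (ε := -1)
        (by simp) using 1
      ring
  have hc : Summable fun n : ℕ => C₀ * (1 / 4 : ℝ) ^ n :=
    (summable_geometric_of_lt_one (by norm_num) (by norm_num)).mul_left _
  have hG1 : ∀ n, IsBoundedKernel lam (C₀ * (1 / 4) ^ n / 2) (volterra σ 1 (G n)) := fun n =>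
    (hG n).volterra hσm hσ hlam (by simp)
  have hα := IsBoundedKernel.tsum hG hc
  have hβ := hα.volterra hσm hσ hlam (ε := 1) (by simp)
  refine ⟨lam, _, _, _, hlam0, hα, ⟨hβ.measurable, fun x t => (hβ.bound x t).trans ?_, hβ.support⟩,
    fun _ _ => rfl, fun x t => ?_⟩
  · exact mul_le_mul_of_nonneg_right (by linarith [hα.nonneg]) (Real.exp_nonneg _)
  · have h1 : volterra σ (-1) (fun x t => firstKernel σ x t
          + volterra σ 1 (fun x t => ∑' n, G n x t) x t) x t
        = volterra σ (-1) (firstKernel σ) x t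
          + volterra σ (-1) (volterra σ 1 (fun x t => ∑' n, G n x t)) x t := by
      rw [volterra, volterra, volterra, ← integral_add (integrableOn_mul_firstKernel hσm hσ x t)
        (hβ.integrableOn hσm hσ (-1) x t)]
      simp only [mul_add]
    have h2 : volterra σ 1 (fun x t => ∑' n, G n x t) = fun x t => ∑' n, volterra σ 1 (G n) x t :=
      funext fun x => funext fun t => volterra_tsum hσm hσ hlam hG hc 1 x t
    rw [h1, h2, volterra_tsum hσm hσ hlam hG1 (hc.div_const 2),
      (IsBoundedKernel.summable hG hc x t).tsum_eq_zero_add]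
    simp only [hGs]
    rfl

end

/-! ### Exponential transforms of kernels -/

/-- A measurable kernel supported in `|t| ≤ x`, with slices bounded by `M` in `L¹` for `x ≤ ℓ`. -/
structure IsIntegrableKernel (ℓ M : ℝ) (g : ℝ → ℝ → ℂ) : Prop where
  measurable : StronglyMeasurable (Function.uncurry g)
  support : ∀ x t, x < |t| → g x t = 0
  integrable : ∀ x ∈ Icc 0 ℓ, Integrable (g x)
  bound : ∀ x ∈ Icc 0 ℓ, ∫ t, ‖g x t‖ ≤ M

/-- The transform `∫ g(x,t) e^{iρt} dt`. -/
def expTransform (ρ : ℂ) (g : ℝ → ℝ → ℂ) (x : ℝ) : ℂ :=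
  ∫ t, g x t * Complex.exp (Complex.I * ρ * t)

theorem norm_mul_exp_le (ρ z : ℂ) {t x : ℝ} (h : x < |t| → z = 0) :
    ‖z * Complex.exp (Complex.I * ρ * t)‖ ≤ Real.exp (‖ρ‖ * x) * ‖z‖ := by
  rcases lt_or_ge x |t| with hx | hx
  · simp [h hx]
  · rw [norm_mul, mul_comm]
    refine mul_le_mul_of_nonneg_right ((Complex.norm_exp_le_exp_norm _).trans
      (Real.exp_le_exp.2 ?_)) (norm_nonneg _)
    rw [norm_mul, norm_mul, Complex.norm_I, one_mul, Complex.norm_real, Real.norm_eq_abs]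
    exact mul_le_mul_of_nonneg_left hx (norm_nonneg _)

theorem exp_shift (ρ : ℂ) (t c : ℝ) :
    Complex.exp (Complex.I * ρ * t)
      = Complex.exp (Complex.I * ρ * (t + c : ℝ)) * Complex.exp (-(Complex.I * ρ * c)) := by
  rw [← Complex.exp_add]
  congr 1
  push_cast
  ring

section

variable {σ : ℝ → ℂ} {ℓ M lam C : ℝ} {g : ℝ → ℝ → ℂ}

theorem IsIntegrableKernel.integrable_mul_exp (hg : IsIntegrableKernel ℓ M g) (ρ : ℂ) {x : ℝ}
    (hx : x ∈ Icc 0 ℓ) : Integrable fun t : ℝ => g x t * Complex.exp (Complex.I * ρ * t) :=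
  ((hg.integrable x hx).norm.const_mul (Real.exp (‖ρ‖ * x))).mono'
    ((hg.integrable x hx).aestronglyMeasurable.mul
      (Continuous.aestronglyMeasurable (by fun_prop)))
    (.of_forall fun t => norm_mul_exp_le ρ _ (hg.support x t))

theorem IsIntegrableKernel.norm_expTransform_le (hg : IsIntegrableKernel ℓ M g) (ρ : ℂ) {x : ℝ}
    (hx : x ∈ Icc 0 ℓ) : ‖expTransform ρ g x‖ ≤ Real.exp (‖ρ‖ * ℓ) * M := by
  have h1 : ‖expTransform ρ g x‖ ≤ ∫ t, Real.exp (‖ρ‖ * x) * ‖g x t‖ :=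
    norm_integral_le_of_norm_le ((hg.integrable x hx).norm.const_mul _)
      (.of_forall fun t => norm_mul_exp_le ρ _ (hg.support x t))
  refine h1.trans ?_
  rw [integral_const_mul]
  exact mul_le_mul (Real.exp_le_exp.2 (mul_le_mul_of_nonneg_left hx.2 (norm_nonneg _)))
    (hg.bound x hx) (integral_nonneg fun _ => norm_nonneg _) (Real.exp_nonneg _)

theorem IsIntegrableKernel.stronglyMeasurable_expTransform (hg : IsIntegrableKernel ℓ M g) (ρ : ℂ) :
    StronglyMeasurable (expTransform ρ g) := by
  refine StronglyMeasurable.integral_prod_right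
    (f := fun x (t : ℝ) => g x t * Complex.exp (Complex.I * ρ * t)) ?_
  have h2 : Continuous fun p : ℝ × ℝ => Complex.exp (Complex.I * ρ * (p.2 : ℂ)) := by fun_prop
  exact hg.measurable.mul h2.stronglyMeasurable

theorem IsIntegrableKernel.add {M' : ℝ} {h : ℝ → ℝ → ℂ} (hg : IsIntegrableKernel ℓ M g)
    (hh : IsIntegrableKernel ℓ M' h) :
    IsIntegrableKernel ℓ (M + M') fun x t => g x t + h x t := by
  refine ⟨hg.measurable.add hh.measurable, fun x t hxt => ?_,
    fun x hx => (hg.integrable x hx).add (hh.integrable x hx), fun x hx => ?_⟩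
  · rw [hg.support x t hxt, hh.support x t hxt, add_zero]
  · refine (integral_mono ((hg.integrable x hx).add (hh.integrable x hx)).norm
      ((hg.integrable x hx).norm.add (hh.integrable x hx).norm) fun t => norm_add_le _ _).trans ?_
    simp only [Pi.add_apply]
    rw [integral_add (hg.integrable x hx).norm (hh.integrable x hx).norm]
    exact add_le_add (hg.bound x hx) (hh.bound x hx)

theorem IsIntegrableKernel.expTransform_add {M' : ℝ} {h : ℝ → ℝ → ℂ}
    (hg : IsIntegrableKernel ℓ M g) (hh : IsIntegrableKernel ℓ M' h) (ρ : ℂ) {x : ℝ}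
    (hx : x ∈ Icc 0 ℓ) :
    expTransform ρ (fun x t => g x t + h x t) x = expTransform ρ g x + expTransform ρ h x := by
  simp only [expTransform, add_mul]
  exact integral_add (hg.integrable_mul_exp ρ hx) (hh.integrable_mul_exp ρ hx)

theorem IsBoundedKernel.norm_le_indicator (hlam0 : 0 ≤ lam) (hg : IsBoundedKernel lam C g) {x : ℝ}
    (hx : x ∈ Icc 0 ℓ) (t : ℝ) :
    ‖g x t‖ ≤ (Icc (-ℓ) ℓ).indicator (fun _ => C * Real.exp (lam * ℓ)) t := by
  by_cases ht : t ∈ Icc (-ℓ) ℓ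
  · rw [indicator_of_mem ht]
    exact (hg.bound x t).trans (mul_le_mul_of_nonneg_left (Real.exp_le_exp.2
      (mul_le_mul_of_nonneg_left hx.2 hlam0)) hg.nonneg)
  · rw [indicator_of_notMem ht, hg.support x t, norm_zero]
    by_contra hc
    exact ht (abs_le.1 ((not_lt.1 hc).trans hx.2))

theorem IsBoundedKernel.exists_isIntegrableKernel (ℓ : ℝ) (hlam0 : 0 ≤ lam)
    (hg : IsBoundedKernel lam C g) : ∃ M, IsIntegrableKernel ℓ M g := by
  have hi : Integrable ((Icc (-ℓ) ℓ).indicator (fun _ => C * Real.exp (lam * ℓ))) := by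
    rw [integrable_indicator_iff measurableSet_Icc]
    exact integrableOn_const (by simp)
  refine ⟨∫ t, (Icc (-ℓ) ℓ).indicator (fun _ => C * Real.exp (lam * ℓ)) t, hg.measurable,
    hg.support, fun x hx => ?_, fun x hx => ?_⟩
  · exact hi.mono' (hg.measurable.comp_measurable
      (g := fun t => (x, t)) (by fun_prop)).aestronglyMeasurable
      (.of_forall fun t => hg.norm_le_indicator hlam0 hx t)
  · exact integral_mono_of_nonneg (.of_forall fun _ => norm_nonneg _) hi
      (.of_forall fun t => hg.norm_le_indicator hlam0 hx t)

theorem integrable_comp_half {u : ℝ → ℝ} (hu : Integrable u) (x : ℝ) :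
    Integrable fun t => u ((x + t) / 2) :=
  (hu.comp_div two_ne_zero).comp_add_left x

theorem integral_comp_half (u : ℝ → ℝ) (x : ℝ) : ∫ t, u ((x + t) / 2) = 2 * ∫ s, u s := by
  rw [integral_add_left_eq_self (fun t => u (t / 2)) x, Measure.integral_comp_div]
  simp

theorem isIntegrableKernel_firstKernel (ℓ : ℝ) (hσm : StronglyMeasurable σ) (hσ : Integrable σ) :
    IsIntegrableKernel ℓ (∫ s, ‖σ s‖) (firstKernel σ) := by
  have hm := stronglyMeasurable_firstKernel hσm
  have hi : ∀ x, Integrable fun t => 1 / 2 * ‖σ ((x + t) / 2)‖ := fun x =>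
    (integrable_comp_half hσ.norm x).const_mul _
  refine ⟨hm, firstKernel_support σ, fun x _ => (hi x).mono' (hm.comp_measurable
      (g := fun t => (x, t)) (by fun_prop)).aestronglyMeasurable
      (.of_forall fun t => norm_firstKernel_le σ x t), fun x _ => ?_⟩
  refine (integral_mono_of_nonneg (.of_forall fun _ => norm_nonneg _) (hi x)
    (.of_forall fun t => norm_firstKernel_le σ x t)).trans (le_of_eq ?_)
  rw [integral_const_mul, integral_comp_half (fun s => ‖σ s‖)]
  ring

/-- Substitution `t = 2s - x`; the Jacobian cancels the factor `1/2` in `firstKernel`. -/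
theorem expTransform_firstKernel (σ : ℝ → ℂ) (ρ : ℂ) {x : ℝ} (hx : 0 ≤ x) :
    expTransform ρ (firstKernel σ) x
      = ∫ s in Ioc 0 x, σ s * Complex.exp (Complex.I * ρ * (2 * s - x)) := by
  rw [expTransform, ← setIntegral_eq_integral_of_forall_compl_eq_zero (s := Icc (-x) x),
    integral_Icc_eq_integral_Ioc, ← intervalIntegral.integral_of_le (by linarith),
    ← intervalIntegral.integral_of_le hx]
  · have h := intervalIntegral.integral_comp_add_div (a := -x) (b := x) (c := 2)
      (fun s : ℝ => σ s * Complex.exp (Complex.I * ρ * (2 * s - x))) two_ne_zero (x / 2)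
    rw [show x / 2 + -x / 2 = 0 by ring, show x / 2 + x / 2 = x by ring] at h
    have h2 : ∫ t in (-x)..x, firstKernel σ x t * Complex.exp (Complex.I * ρ * t)
        = (1 / 2 : ℂ) * ∫ t in (-x)..x, σ (x / 2 + t / 2) *
          Complex.exp (Complex.I * ρ * (2 * (x / 2 + t / 2 : ℝ) - x)) := by
      rw [← intervalIntegral.integral_const_mul]
      refine intervalIntegral.integral_congr fun t ht => ?_
      rw [uIcc_of_le (by linarith)] at ht
      simp only [firstKernel, if_pos (abs_le.2 ht)]
      rw [mul_assoc]
      congr 3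
      · ring
      · congr 2
        push_cast
        ring
    rw [h2, h, Complex.real_smul]
    push_cast
    ring
  · intro t ht
    rw [firstKernel_support, zero_mul]
    by_contra hc
    exact ht (abs_le.1 (not_lt.1 hc))

/-- Fubini, then translation in `t`, which costs the factor `e^{-iρε(x-s)}`. Volterra operators on
kernels thus become Duhamel integrals. -/
theorem expTransform_volterra (hσm : StronglyMeasurable σ) (hσ : Integrable σ) {ε : ℝ}
    (hε : |ε| = 1) (hg : IsIntegrableKernel ℓ M g) (ρ : ℂ) {x : ℝ} (hx : x ∈ Icc 0 ℓ) :
    expTransform ρ (volterra σ ε g) x = ∫ s in Ioc 0 x,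
      σ s * Complex.exp (-(Complex.I * ρ * (ε * (x - s) : ℝ))) * expTransform ρ g s := by
  have hIcc : ∀ s ∈ Ioc 0 x, s ∈ Icc 0 ℓ := fun s hs => ⟨hs.1.le, hs.2.trans hx.2⟩
  set Φ : ℝ → ℝ → ℂ := fun t s =>
    σ s * g s (t + ε * (x - s)) * Complex.exp (Complex.I * ρ * t) with hΦ
  have hΦm : StronglyMeasurable (Function.uncurry Φ) := by
    have h1 : StronglyMeasurable fun p : ℝ × ℝ => σ p.2 := hσm.comp_measurable measurable_snd
    have h2 := hg.measurable.comp_measurable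
      (g := fun p : ℝ × ℝ => (p.2, p.1 + ε * (x - p.2))) (by fun_prop)
    have h3 : Continuous fun p : ℝ × ℝ => Complex.exp (Complex.I * ρ * (p.1 : ℂ)) := by fun_prop
    exact (h1.mul h2).mul h3.stronglyMeasurable
  have hΦb : ∀ s ∈ Ioc 0 x, ∀ t,
      ‖Φ t s‖ ≤ Real.exp (‖ρ‖ * x) * (‖σ s‖ * ‖g s (t + ε * (x - s))‖) := by
    intro s hs t
    rw [← norm_mul]
    refine norm_mul_exp_le ρ _ fun hxt => ?_
    rw [hg.support, mul_zero]
    have h1 : |ε * (x - s)| = x - s := by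
      rw [abs_mul, hε, one_mul, abs_of_nonneg (by linarith [hs.2])]
    have h2 : |t| ≤ |t + ε * (x - s)| + |ε * (x - s)| := by
      simpa using abs_sub (t + ε * (x - s)) (ε * (x - s))
    linarith
  have hsl : ∀ s ∈ Ioc 0 x, Integrable fun t =>
      Real.exp (‖ρ‖ * x) * (‖σ s‖ * ‖g s (t + ε * (x - s))‖) := fun s hs =>
    ((((hg.integrable s (hIcc s hs)).comp_add_right (ε * (x - s))).norm).const_mul _).const_mul _
  have hΦi : Integrable (Function.uncurry Φ) (volume.prod (volume.restrict (Ioc 0 x))) := by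
    rw [integrable_prod_iff' hΦm.aestronglyMeasurable]
    constructor
    · filter_upwards [ae_restrict_mem measurableSet_Ioc] with s hs
      exact (hsl s hs).mono' (hΦm.comp_measurable
        (g := fun t => (t, s)) (by fun_prop)).aestronglyMeasurable (.of_forall (hΦb s hs))
    · refine Integrable.mono' ((hσ.norm.const_mul (Real.exp (‖ρ‖ * x) * M)).restrict)
        (hΦm.norm.integral_prod_left'.aestronglyMeasurable) ?_
      filter_upwards [ae_restrict_mem measurableSet_Ioc] with s hs
      rw [Real.norm_of_nonneg (integral_nonneg fun _ => norm_nonneg _)]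
      refine (integral_mono_of_nonneg (.of_forall fun _ => norm_nonneg _) (hsl s hs)
        (.of_forall (hΦb s hs))).trans ?_
      rw [integral_const_mul, integral_const_mul,
        integral_add_right_eq_self (fun t => ‖g s t‖), mul_assoc, mul_comm M]
      exact mul_le_mul_of_nonneg_left (mul_le_mul_of_nonneg_left (hg.bound s (hIcc s hs))
        (norm_nonneg _)) (Real.exp_nonneg _)
  calc expTransform ρ (volterra σ ε g) x = ∫ t, ∫ s in Ioc 0 x, Φ t s := by
        simp only [expTransform, volterra, hΦ, integral_mul_const]
    _ = ∫ s in Ioc 0 x, ∫ t, Φ t s := integral_integral_swap hΦi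
    _ = _ := by
        refine integral_congr_ae (.of_forall fun s => ?_)
        simp only [hΦ, expTransform]
        rw [← integral_const_mul,
          ← integral_add_right_eq_self (fun t : ℝ => σ s * Complex.exp
            (-(Complex.I * ρ * (ε * (x - s) : ℝ))) * (g s t * Complex.exp (Complex.I * ρ * t)))
            (ε * (x - s))]
        refine integral_congr_ae (.of_forall fun t => ?_)
        simp only
        rw [exp_shift ρ t (ε * (x - s))]
        ring

theorem memLp_two_firstKernel (hσm : StronglyMeasurable σ) (hσ : MemLp σ 2) (x : ℝ) :
    MemLp (firstKernel σ x) 2 := by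
  have hm : AEStronglyMeasurable (firstKernel σ x) volume :=
    ((stronglyMeasurable_firstKernel hσm).comp_measurable
      (g := fun t => (x, t)) (by fun_prop)).aestronglyMeasurable
  have hi : Integrable fun s => ‖σ s‖ ^ 2 := (memLp_two_iff_integrable_sq_norm hσ.1).1 hσ
  rw [memLp_two_iff_integrable_sq_norm hm]
  refine ((integrable_comp_half hi x).const_mul ((1 / 2) ^ 2)).mono' (hm.norm.pow 2)
    (.of_forall fun t => ?_)
  rw [Real.norm_of_nonneg (by positivity), ← mul_pow]
  exact pow_le_pow_left₀ (norm_nonneg _) (norm_firstKernel_le σ x t) 2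

/-- Every slice has squared norm at most `1/2 ∫ ‖σ‖²`, uniformly in `x`, and `x` ranges over a
bounded interval. -/
theorem memLp_two_firstKernel_triangle (hσm : StronglyMeasurable σ) (hσ : MemLp σ 2) (ℓ : ℝ) :
    MemLp (Function.uncurry (firstKernel σ)) 2 (volume.restrict (triangle ℓ)) := by
  have hm := stronglyMeasurable_firstKernel hσm
  have hi : Integrable fun s => ‖σ s‖ ^ 2 := (memLp_two_iff_integrable_sq_norm hσ.1).1 hσ
  have hsq : ∀ x t, ‖firstKernel σ x t‖ ^ 2 ≤ (1 / 2) ^ 2 * ‖σ ((x + t) / 2)‖ ^ 2 := fun x t => by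
    rw [← mul_pow]
    exact pow_le_pow_left₀ (norm_nonneg _) (norm_firstKernel_le σ x t) 2
  have key : Integrable (fun p : ℝ × ℝ => ‖Function.uncurry (firstKernel σ) p‖ ^ 2)
      ((volume.restrict (Icc 0 ℓ)).prod volume) := by
    have hm2 : StronglyMeasurable fun p => ‖Function.uncurry (firstKernel σ) p‖ ^ 2 :=
      hm.norm.pow 2
    rw [integrable_prod_iff hm2.aestronglyMeasurable]
    refine ⟨.of_forall fun x => (memLp_two_iff_integrable_sq_norm
      (memLp_two_firstKernel hσm hσ x).1).1 (memLp_two_firstKernel hσm hσ x), ?_⟩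
    refine Integrable.mono' (integrable_const (1 / 2 * ∫ s, ‖σ s‖ ^ 2))
      hm2.norm.integral_prod_right'.aestronglyMeasurable (.of_forall fun x => ?_)
    rw [Real.norm_of_nonneg (integral_nonneg fun _ => norm_nonneg _)]
    refine (integral_mono_of_nonneg (.of_forall fun _ => norm_nonneg _)
      ((integrable_comp_half hi x).const_mul ((1 / 2) ^ 2)) (.of_forall fun t => ?_)).trans
      (le_of_eq ?_)
    · simp only [Function.uncurry_apply_pair, norm_pow, norm_norm]
      exact hsq x t
    · rw [integral_const_mul, integral_comp_half (fun s => ‖σ s‖ ^ 2)]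
      ring
  rw [memLp_two_iff_integrable_sq_norm hm.aestronglyMeasurable]
  refine key.mono_measure ?_
  have h1 : (volume.restrict (Icc 0 ℓ)).prod (volume : Measure ℝ)
      = volume.restrict (Icc 0 ℓ ×ˢ (univ : Set ℝ)) := by
    rw [Measure.volume_eq_prod, ← Measure.prod_restrict, Measure.restrict_univ]
  have h2 : triangle ℓ ⊆ Icc 0 ℓ ×ˢ (univ : Set ℝ) := fun p hp => ⟨⟨hp.1, hp.2.1⟩, mem_univ _⟩
  rw [h1]
  exact Measure.restrict_mono h2 le_rfl

end

/-! ### The Schrödinger kernel -/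

section

variable {σ : ℝ → ℂ} {ℓ : ℝ}

/-- Variation of constants, read backwards: Duhamel's formula is differentiated by the product rule.
-/
theorem isPrimitiveOn_exp_mul {ℓ : ℝ} (hℓ : 0 ≤ ℓ) {h : ℝ → ℂ} (c : ℂ) (κ : ℂ)
    (hh : IntervalIntegrable h volume 0 ℓ) {A : ℝ → ℂ}
    (hA : ∀ x ∈ Icc 0 ℓ, A x = Complex.exp (Complex.I * κ * x) *
      (c + ∫ s in Ioc 0 x, h s)) :
    IsPrimitiveOn 0 ℓ A fun x => Complex.I * κ * A x + Complex.exp (Complex.I * κ * x) * h x := by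
  have h1 : IsPrimitiveOn 0 ℓ (fun x => c + ∫ s in (0 : ℝ)..x, h s) h := ⟨hh, by simp⟩
  have h2 := ((isPrimitiveOn_exp 0 ℓ κ).mul hℓ h1).congr hℓ (v := A) fun x hx => by
    rw [hA x hx, ← intervalIntegral.integral_of_le hx.1]
  refine h2.congr_deriv hℓ (.of_forall fun x hx => ?_)
  rw [hA x (Ioo_subset_Icc_self hx), ← intervalIntegral.integral_of_le hx.1.le]
  ring

theorem intervalIntegrable_mul_exp_mul (hℓ : 0 ≤ ℓ) (hσ : Integrable σ) (κ : ℂ) {B : ℝ → ℂ}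
    (hB : StronglyMeasurable B) {M : ℝ} (hM : ∀ x ∈ Icc 0 ℓ, ‖B x‖ ≤ M) :
    IntervalIntegrable (fun s => σ s * Complex.exp (Complex.I * κ * s) * B s) volume 0 ℓ := by
  rw [intervalIntegrable_iff_integrableOn_Icc_of_le hℓ]
  have h1 : IntegrableOn (fun s : ℝ => σ s * Complex.exp (Complex.I * κ * s)) (Icc 0 ℓ) :=
    hσ.integrableOn.mul_continuousOn (by fun_prop) isCompact_Icc
  exact h1.mul_bdd (c := M) hB.aestronglyMeasurable
    ((ae_restrict_iff' measurableSet_Icc).2 (.of_forall hM))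

/-- A kernel whose transforms, together with `e^{iρx}`, solve the first order Schrödinger system. -/
theorem exists_kernel_isPrimitiveOn (hℓ : 0 ≤ ℓ) (hσm : StronglyMeasurable σ) (hσ : MemLp σ 2)
    (hσ1 : Integrable σ) :
    ∃ K : ℝ → ℝ → ℂ, (∃ M, IsIntegrableKernel ℓ M K) ∧ (∀ x ∈ Icc 0 ℓ, MemLp (K x) 2) ∧
      MemLp (Function.uncurry K) 2 (volume.restrict (triangle ℓ)) ∧
      ∀ ρ : ℂ, ∃ w : ℝ → ℂ, ∀ y : ℝ → ℂ,
        (∀ x, y x = Complex.exp (Complex.I * ρ * x) + expTransform ρ K x) →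
        IsPrimitiveOn 0 ℓ y (fun x => σ x * y x + w x) ∧
        IsPrimitiveOn 0 ℓ w (fun x => -(σ x * w x) - ρ ^ 2 * y x) ∧
        y 0 = 1 ∧ w 0 = Complex.I * ρ := by
  obtain ⟨lam, C, α, β, hlam0, hα, hβ, hβα, hαβ⟩ := exists_kernel_pair hσm hσ
  obtain ⟨M₁, hα1⟩ := hα.exists_isIntegrableKernel ℓ hlam0
  obtain ⟨M₂, hβ1⟩ := hβ.exists_isIntegrableKernel ℓ hlam0
  have hγ1 := (isIntegrableKernel_firstKernel ℓ hσm hσ1).add hβ1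
  have hK := hα1.add hγ1
  set γ : ℝ → ℝ → ℂ := fun x t => firstKernel σ x t + β x t with hγ
  refine ⟨fun x t => α x t + γ x t, ⟨_, hK⟩, fun x hx => ?_, ?_, fun ρ => ?_⟩
  · have hb : ∀ {g : ℝ → ℝ → ℂ}, IsBoundedKernel lam C g → MemLp (g x) 2 := by
      intro g hg
      have hi : MemLp ((Icc (-ℓ) ℓ).indicator (fun _ => C * Real.exp (lam * ℓ))) 2 volume := by
        rw [memLp_indicator_iff_restrict measurableSet_Icc]
        exact memLp_const _
      exact hi.mono' (hg.measurable.comp_measurable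
        (g := fun t => (x, t)) (by fun_prop)).aestronglyMeasurable
        (.of_forall fun t => hg.norm_le_indicator hlam0 hx t)
    exact (hb hα).add ((memLp_two_firstKernel hσm hσ x).add (hb hβ))
  · have hfin : IsFiniteMeasure (volume.restrict (triangle ℓ)) :=
      ⟨by simpa using (isCompact_triangle ℓ).measure_lt_top⟩
    have hb : ∀ {g : ℝ → ℝ → ℂ}, IsBoundedKernel lam C g →
        MemLp (Function.uncurry g) 2 (volume.restrict (triangle ℓ)) := by
      intro g hg
      refine (memLp_top_of_bound hg.measurable.aestronglyMeasurable
        (C * Real.exp (lam * ℓ)) ?_).mono_exponent le_top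
      filter_upwards [ae_restrict_mem (isClosed_triangle ℓ).measurableSet] with p hp
      exact (hg.bound p.1 p.2).trans (mul_le_mul_of_nonneg_left (Real.exp_le_exp.2
        (mul_le_mul_of_nonneg_left hp.2.1 hlam0)) hg.nonneg)
    exact (hb hα).add ((memLp_two_firstKernel_triangle hσm hσ ℓ).add (hb hβ))
  -- `A` and `B` are the waves travelling in the two directions: `A' = iρA + σB`, `B' = -iρB + σA`.
  · set A : ℝ → ℂ := fun x => Complex.exp (Complex.I * ρ * x) + expTransform ρ α x with hA
    set B : ℝ → ℂ := expTransform ρ γ with hB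
    have hAm : StronglyMeasurable A :=
      (Continuous.stronglyMeasurable (by fun_prop)).add (hα1.stronglyMeasurable_expTransform ρ)
    have hAb : ∀ x ∈ Icc 0 ℓ, ‖A x‖ ≤ Real.exp (‖ρ‖ * ℓ) + Real.exp (‖ρ‖ * ℓ) * M₁ := by
      intro x hx
      refine (norm_add_le _ _).trans (add_le_add ?_ (hα1.norm_expTransform_le ρ hx))
      have := norm_mul_exp_le ρ 1 (t := x) (x := ℓ) fun h => by
        rw [abs_of_nonneg hx.1] at h
        linarith [hx.2]
      simpa using this
    have hAeq : ∀ x ∈ Icc 0 ℓ, A x = Complex.exp (Complex.I * ρ * x) *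
        (1 + ∫ s in Ioc 0 x, σ s * Complex.exp (Complex.I * (-ρ) * s) * B s) := by
      intro x hx
      have h1 : expTransform ρ α x = expTransform ρ (volterra σ (-1) γ) x := by
        simp only [expTransform, hαβ]
      rw [hA, mul_add, mul_one, ← integral_const_mul]
      simp only
      rw [h1, expTransform_volterra hσm hσ1 (by simp) hγ1 ρ hx]
      congr 1
      refine integral_congr_ae (.of_forall fun s => ?_)
      simp only
      rw [show -(Complex.I * ρ * ((-1 * (x - s) : ℝ) : ℂ))
        = Complex.I * ρ * x + Complex.I * (-ρ) * s by push_cast; ring, Complex.exp_add]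
      ring
    have hBeq : ∀ x ∈ Icc 0 ℓ, B x = Complex.exp (Complex.I * (-ρ) * x) *
        (0 + ∫ s in Ioc 0 x, σ s * Complex.exp (Complex.I * ρ * s) * A s) := by
      intro x hx
      have h1 : expTransform ρ β x = expTransform ρ (volterra σ 1 α) x := by
        simp only [expTransform, hβα]
      have hsub : Ioc 0 x ⊆ Icc 0 ℓ := fun s hs => ⟨hs.1.le, hs.2.trans hx.2⟩
      have i1 : IntegrableOn (fun s : ℝ =>
          σ s * Complex.exp (Complex.I * ρ * (2 * s - x))) (Ioc 0 x) :=
        (hσ1.integrableOn.mul_continuousOn (K := Icc 0 ℓ) (by fun_prop) isCompact_Icc).mono_set hsub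
      have i2 : IntegrableOn (fun s : ℝ => σ s *
          Complex.exp (-(Complex.I * ρ * (1 * (x - s) : ℝ))) * expTransform ρ α s) (Ioc 0 x) := by
        have h2 : IntegrableOn (fun s : ℝ => σ s *
            Complex.exp (-(Complex.I * ρ * (1 * (x - s) : ℝ)))) (Ioc 0 x) :=
          (hσ1.integrableOn.mul_continuousOn (K := Icc 0 ℓ)
            (by fun_prop) isCompact_Icc).mono_set hsub
        exact h2.mul_bdd (c := Real.exp (‖ρ‖ * ℓ) * M₁)
          (hα1.stronglyMeasurable_expTransform ρ).aestronglyMeasurable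
          ((ae_restrict_iff' measurableSet_Ioc).2
            (.of_forall fun s hs => hα1.norm_expTransform_le ρ (hsub hs)))
      rw [hB, (isIntegrableKernel_firstKernel ℓ hσm hσ1).expTransform_add hβ1 ρ hx, h1,
        expTransform_firstKernel σ ρ hx.1, expTransform_volterra hσm hσ1 (by simp) hα1 ρ hx,
        ← integral_add i1 i2, zero_add, ← integral_const_mul]
      refine integral_congr_ae (.of_forall fun s => ?_)
      simp only [hA]
      -- `firstKernel` accounts for the free wave `e^{iρs}` in `A s`, and `β` for the transform of
      -- `α`.
      rw [show Complex.I * ρ * (2 * s - x)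
        = Complex.I * (-ρ) * x + Complex.I * ρ * s + Complex.I * ρ * s by ring,
        show -(Complex.I * ρ * ((1 * (x - s) : ℝ) : ℂ))
        = Complex.I * (-ρ) * x + Complex.I * ρ * s by push_cast; ring, Complex.exp_add,
        Complex.exp_add]
      ring
    have hAp := isPrimitiveOn_exp_mul hℓ 1 ρ (intervalIntegrable_mul_exp_mul hℓ hσ1 (-ρ)
      (hγ1.stronglyMeasurable_expTransform ρ) fun x hx => hγ1.norm_expTransform_le ρ hx) hAeq
    have hBp := isPrimitiveOn_exp_mul hℓ 0 (-ρ) (intervalIntegrable_mul_exp_mul hℓ hσ1 ρ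
      hAm hAb) hBeq
    have hexp : ∀ x : ℝ, Complex.exp (Complex.I * (-ρ) * x) =
        (Complex.exp (Complex.I * ρ * x))⁻¹ := fun x => by
      rw [← Complex.exp_neg]
      congr 1
      ring
    have h0 : (0 : ℝ) ∈ Icc 0 ℓ := ⟨le_rfl, hℓ⟩
    have hA0 : A 0 = 1 := by simpa using hAeq 0 h0
    have hB0 : B 0 = 0 := by simpa using hBeq 0 h0
    refine ⟨fun x => Complex.I * ρ * A x + -(Complex.I * ρ) * B x, fun y hy => ?_⟩
    have hyAB : ∀ x ∈ Icc 0 ℓ, A x + B x = y x := fun x hx => by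
      rw [hy, hα1.expTransform_add hγ1 ρ hx]
      simp only [hA, hB]
      ring
    refine ⟨((hAp.add hBp).congr hℓ hyAB).congr_deriv hℓ (.of_forall fun x hx => ?_),
      ((hAp.const_mul _).add (hBp.const_mul _)).congr_deriv hℓ (.of_forall fun x hx => ?_), ?_, ?_⟩
    · rw [← hyAB x (Ioo_subset_Icc_self hx), hexp]
      have := Complex.exp_ne_zero (Complex.I * ρ * x)
      field_simp
      ring
    · rw [← hyAB x (Ioo_subset_Icc_self hx), hexp]
      have := Complex.exp_ne_zero (Complex.I * ρ * x)
      have hI := Complex.I_sq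
      field_simp
      linear_combination (ρ ^ 2 * A x + ρ ^ 2 * B x) * hI
    · rw [← hyAB 0 h0, hA0, hB0, add_zero]
    · simp [hA0, hB0]

end

/-- The extra properties are used later: square integrable slices for the `W^{1,2}` regularity of
`Kh`, measurability and the uniform `L¹` bound for the impedance kernel. -/
theorem exists_isSchrodingerKernel {ℓ : ℝ} {f f' : ℝ → ℂ} (hℓ : 0 < ℓ) (hf : HasW12Deriv 0 ℓ f f')
    (hfc : ContinuousOn f (Icc 0 ℓ)) (hf_ne : ∀ x ∈ Icc 0 ℓ, f x ≠ 0) :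
    ∃ K : ℝ → ℝ → ℂ, StronglyMeasurable (Function.uncurry K) ∧
      (∀ x ∈ Ioc 0 ℓ, MemLp (K x) 2 (volume.restrict (Ioo (-x) x))) ∧
      (∃ M : ℝ, ∀ x ∈ Ioc 0 ℓ, ∫ t in (-x)..x, ‖K x t‖ ≤ M) ∧ IsSchrodingerKernel ℓ f f' K := by
  have hq := memLp_two_logDeriv hf hfc hf_ne
  -- A strongly measurable representative of `f'/f`, extended by zero to the line.
  set σ : ℝ → ℂ := (Ioo 0 ℓ).indicator (hq.1.mk _) with hσdef
  have hσm : StronglyMeasurable σ := hq.1.stronglyMeasurable_mk.indicator measurableSet_Ioo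
  have hq' := hq.ae_eq hq.1.ae_eq_mk
  have hσ : MemLp σ 2 := (memLp_indicator_iff_restrict measurableSet_Ioo).2 hq'
  have hσ1 : Integrable σ :=
    (integrable_indicator_iff measurableSet_Ioo).2 (hq'.integrable (by norm_num))
  have hσf : ∀ᵐ x, x ∈ Ioo 0 ℓ → σ x = f' x / f x := by
    filter_upwards [(ae_restrict_iff' measurableSet_Ioo).1 hq.1.ae_eq_mk] with x hx hx0
    rw [hσdef, indicator_of_mem hx0, ← hx hx0]
  obtain ⟨K, ⟨M, hK⟩, h₂, hT, hsys⟩ := exists_kernel_isPrimitiveOn hℓ.le hσm hσ hσ1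
  refine ⟨K, hK.measurable, fun x hx => (h₂ x (Ioc_subset_Icc_self hx)).restrict _,
    ⟨M, fun x hx => ?_⟩, ⟨hT, fun x hx => (hK.integrable x
      (Ioc_subset_Icc_self hx)).intervalIntegrable⟩, fun ρ => ?_⟩
  · rw [intervalIntegral.integral_of_le (by linarith [hx.1])]
    exact (setIntegral_le_integral (hK.integrable x (Ioc_subset_Icc_self hx)).norm
      (.of_forall fun _ => norm_nonneg _)).trans (hK.bound x (Ioc_subset_Icc_self hx))
  · obtain ⟨w, hw⟩ := hsys ρ
    obtain ⟨h1, h2, h3, h4⟩ := hw _ fun _ => rfl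
    refine ⟨_, IsSchrodingerSystem.isSchrodingerExp hℓ hf hfc hf_ne (w := w)
      ⟨h1.congr_deriv hℓ.le ?_, h2.congr_deriv hℓ.le ?_, h3, h4⟩, fun x hx => ?_⟩
    · filter_upwards [hσf] with x hx hx0
      rw [hx hx0]
    · filter_upwards [hσf] with x hx hx0
      rw [hx hx0]
    · rw [expTransform, ← setIntegral_eq_integral_of_forall_compl_eq_zero (s := Icc (-x) x),
        integral_Icc_eq_integral_Ioc, ← intervalIntegral.integral_of_le (by linarith [hx.1])]
      intro t ht
      rw [hK.support, zero_mul]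
      by_contra hc
      exact ht (abs_le.1 (not_lt.1 hc))

/-! ### Existence of the impedance kernel -/

section Kernels

variable {ℓ : ℝ} {f f' : ℝ → ℂ}

/-- The primitive of a Schrödinger kernel, divided by `f`, is an impedance kernel. -/
theorem isImpedanceKernel_primitive (hℓ : 0 < ℓ) (hf : HasW12Deriv 0 ℓ f f')
    (hfc : ContinuousOn f (Icc 0 ℓ)) (hf_ne : ∀ x ∈ Icc 0 ℓ, f x ≠ 0) (hf_zero : f 0 = 1)
    {K : ℝ → ℝ → ℂ} (hm : StronglyMeasurable (Function.uncurry K))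
    {M : ℝ} (hM : ∀ x ∈ Ioc 0 ℓ, ∫ t in (-x)..x, ‖K x t‖ ≤ M)
    (hK : IsSchrodingerKernel ℓ f f' K) :
    IsImpedanceKernel ℓ f fun x t => 1 / f x * ∫ s in (-x)..t, K x s := by
  have hprim : ∀ x ∈ Ioc 0 ℓ, IsPrimitiveOn (-x) x (fun t => 1 / f x * ∫ s in (-x)..t, K x s)
      (fun t => 1 / f x * K x t) := fun x hx =>
    ⟨(hK.1.2 x hx).const_mul _, fun t _ => by simp⟩
  refine ⟨⟨?_, fun x hx => ?_⟩, fun ρ => ?_⟩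
  · have hmJ : AEStronglyMeasurable
        (fun p : ℝ × ℝ => 1 / f p.1 * ∫ s, (Ioc (-p.1) p.2).indicator (K p.1) s)
        (volume.restrict (triangle ℓ)) := by
      refine AEStronglyMeasurable.mul ?_ ?_
      · refine ContinuousOn.aestronglyMeasurable ?_ (isClosed_triangle ℓ).measurableSet
        have h1 : ContinuousOn (fun x => 1 / f x) (Icc 0 ℓ) := continuousOn_const.div hfc hf_ne
        exact h1.comp continuous_fst.continuousOn fun p hp => ⟨hp.1, hp.2.1⟩
      · refine StronglyMeasurable.aestronglyMeasurable ?_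
        refine StronglyMeasurable.integral_prod_right
          (f := fun (p : ℝ × ℝ) s => (Ioc (-p.1) p.2).indicator (K p.1) s) ?_
        have hS₁ : MeasurableSet {q : (ℝ × ℝ) × ℝ | -q.1.1 < q.2} :=
          measurableSet_lt (by fun_prop) (by fun_prop)
        have hS₂ : MeasurableSet {q : (ℝ × ℝ) × ℝ | q.2 ≤ q.1.2} :=
          measurableSet_le (by fun_prop) (by fun_prop)
        exact (hm.comp_measurable (g := fun q : (ℝ × ℝ) × ℝ => (q.1.1, q.2))
          (by fun_prop)).indicator (hS₁.inter hS₂)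
    obtain ⟨C, hC⟩ := isCompact_Icc.exists_bound_of_continuousOn
      (continuousOn_const.div hfc hf_ne : ContinuousOn (fun x => 1 / f x) (Icc 0 ℓ))
    have hC0 : 0 ≤ C := (norm_nonneg _).trans (hC 0 ⟨le_rfl, hℓ.le⟩)
    have hM0 : 0 ≤ M := (intervalIntegral.integral_nonneg (by linarith)
      fun _ _ => norm_nonneg _).trans (hM ℓ ⟨hℓ, le_rfl⟩)
    have hfin : IsFiniteMeasure (volume.restrict (triangle ℓ)) :=
      ⟨by simpa using (isCompact_triangle ℓ).measure_lt_top⟩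
    refine (memLp_top_of_bound (hmJ.congr ?_) (C * M) ?_).mono_exponent le_top
    · filter_upwards [ae_restrict_mem (isClosed_triangle ℓ).measurableSet] with p hp
      have := abs_le.1 hp.2.2
      simp only [Function.uncurry_def]
      rw [intervalIntegral.integral_of_le this.1, integral_indicator measurableSet_Ioc]
    · filter_upwards [ae_restrict_mem (isClosed_triangle ℓ).measurableSet] with p hp
      have hp2 := abs_le.1 hp.2.2
      rw [Function.uncurry_def, norm_mul]
      refine mul_le_mul (hC _ ⟨hp.1, hp.2.1⟩) ?_ (norm_nonneg _) hC0
      -- At the vertex `x = 0` the bound `hM` is not available, but the interval of integration is a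
      -- point.
      rcases hp.1.eq_or_lt with h0 | h0
      · have : p.2 = -p.1 := by linarith [hp2.1, hp2.2]
        simpa [this] using hM0
      · have hx : p.1 ∈ Ioc 0 ℓ := ⟨h0, hp.2.1⟩
        refine (intervalIntegral.norm_integral_le_integral_norm hp2.1).trans
          (le_trans ?_ (hM p.1 hx))
        exact intervalIntegral.integral_mono_interval le_rfl hp2.1 hp2.2
          (.of_forall fun _ => norm_nonneg _) (hK.1.2 p.1 hx).norm
  · have h1 := (hprim x hx).continuousOn (by linarith [hx.1])
    rw [← uIcc_of_le (by linarith [hx.1])] at h1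
    exact h1.intervalIntegrable
  · obtain ⟨e, he, h⟩ := hK.2 ρ
    obtain ⟨w, hw⟩ := he.exists_isSchrodingerSystem hℓ hf hfc hf_ne
    refine ⟨fun x => e x / f x, (hw.isImpedanceSystem hℓ hf hfc hf_ne hf_zero).isImpedanceExp
      hℓ hf hfc hf_ne hf_zero, fun x hx => ?_⟩
    have hx' := Ioc_subset_Icc_self hx
    -- Frequency zero gives `f x = 1 + ∫ K(x,t) dt`, hence the end value `1 - 1/f x`.
    obtain ⟨e₀, he₀, h₀⟩ := hK.2 0
    obtain ⟨w₀, hw₀⟩ := he₀.exists_isSchrodingerSystem hℓ hf hfc hf_ne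
    have h1 := h₀ x hx
    rw [hw₀.eqOn hℓ hf hfc hf_ne hf_zero
      (isSchrodingerSystem_zero hℓ hf hfc hf_ne hf_zero) hx'] at h1
    simp only [mul_zero, zero_mul, Complex.exp_zero, mul_one] at h1
    rw [integral_primitive_mul_exp hx.1.le (hprim x hx) (by simp)]
    · simp only [h x hx]
      ring
    · rw [eq_sub_of_add_eq' h1.symm]
      field_simp [hf_ne x hx']

end Kernels

end Transmutation

end

/-! ### The main theorem -/

open Transmutation in
theorem mainTheorem9 (ℓ : ℝ) (hℓ : 0 < ℓ) (f f' : ℝ → ℂ)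
    (hf : HasW12Deriv 0 ℓ f f') (hfc : ContinuousOn f (Icc 0 ℓ))
    (hf_ne : ∀ x ∈ Icc 0 ℓ, f x ≠ 0) (hf_zero : f 0 = 1) :
    -- both kernels exist
    (∃ K : ℝ → ℝ → ℂ, IsSchrodingerKernel ℓ f f' K) ∧
    (∃ Kh : ℝ → ℝ → ℂ, IsImpedanceKernel ℓ f Kh) ∧
    -- and any representatives of them have the following properties
    ∀ K Kh : ℝ → ℝ → ℂ, IsSchrodingerKernel ℓ f f' K → IsImpedanceKernel ℓ f Kh →
      -- (i) the two transmutation operators are related by division by `f`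
      (∀ v v' : ℝ → ℂ, HasW12Deriv (-ℓ) ℓ v v' →
        (∀ᵐ x ∂(volume.restrict (Ioo 0 ℓ)),
          impedanceOp Kh v v' x = 1 / f x * schrodingerOp K v x) ∧
        (ContinuousOn v (Icc (-ℓ) ℓ) → ∀ x ∈ Icc 0 ℓ,
          impedanceOp Kh v v' x = 1 / f x * schrodingerOp K v x)) ∧
      -- (ii) for each `x` the slice is in `W^{1,2}(-x,x)`, with `t`-derivative `K / f(x)`
      (∀ x ∈ Ioc 0 ℓ, HasW12Deriv (-x) x (Kh x) (fun t => 1 / f x * K x t)) ∧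
      (∀ dKh : ℝ → ℝ → ℂ,
        AEStronglyMeasurable (Function.uncurry dKh) (volume.restrict (triangle ℓ)) →
        (∀ x ∈ Ioc 0 ℓ, HasW12Deriv (-x) x (Kh x) (dKh x)) →
        ∀ᵐ p ∂(volume.restrict (triangle ℓ)), dKh p.1 p.2 = 1 / f p.1 * K p.1 p.2) ∧
      -- (iii) Goursat conditions, for the continuous representative of each slice
      (∀ x ∈ Ioc 0 ℓ, ∃ k : ℝ → ℂ, IsContinuousRep (-x) x (Kh x) k ∧
        k x = 1 - 1 / f x ∧ k (-x) = 0) := by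
  obtain ⟨K₀, hm, h₂, ⟨M, hM⟩, hK₀⟩ := exists_isSchrodingerKernel hℓ hf hfc hf_ne
  refine ⟨⟨K₀, hK₀⟩, ⟨_, isImpedanceKernel_primitive hℓ hf hfc hf_ne hf_zero hm hM hK₀⟩,
    fun K Kh hK hKh => ?_⟩
  have hH := fun (x : ℝ) (hx : x ∈ Ioc 0 ℓ) =>
    exists_primitive_of_kernels hℓ hf hfc hf_ne hf_zero hK hKh hx
  have hprim : ∀ x ∈ Ioc 0 ℓ, HasW12Deriv (-x) x (Kh x) (fun t => 1 / f x * K x t) := by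
    intro x hx
    obtain ⟨H, h1, -, -, h4⟩ := hH x hx
    -- Slices of an arbitrary kernel are only assumed integrable; for every `x` they inherit square
    -- integrability from `K₀` by uniqueness.
    have hK2 : MemLp (K x) 2 (volume.restrict (Ioo (-x) x)) :=
      (h₂ x hx).ae_eq ((ae_restrict_iff' measurableSet_Ioo).2
        (hK₀.ae_unique hℓ hf hfc hf_ne hf_zero hK hx))
    have h5 := h1.hasW12Deriv (by linarith [hx.1]) (hK2.const_mul _)
    have h6 : H =ᵐ[volume.restrict (Ioo (-x) x)] Kh x :=
      (ae_restrict_iff' measurableSet_Ioo).2 h4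
    refine ⟨h5.memLp.ae_eq h6, h5.memLp_deriv, fun φ hφ => ?_⟩
    rw [← h5.weak φ hφ]
    refine integral_congr_ae ?_
    filter_upwards [h6] with t ht
    rw [ht]
  refine ⟨fun v v' hv => ?_, hprim, fun dKh hdm hd => ?_, fun x hx => ?_⟩
  · have hℓℓ : -ℓ < ℓ := by linarith
    have hv'i := memLp_two_intervalIntegrable hℓℓ.le hv.memLp_deriv
    obtain ⟨c, hc⟩ := exists_ae_eq_const_add_integral hℓℓ
      (memLp_two_intervalIntegrable hℓℓ.le hv.memLp) hv'i hv.weak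
    -- The continuous representative of `v`. The integrals do not distinguish it from `v`, so only
    -- the value at `x` itself has to agree.
    set V : ℝ → ℂ := fun x => c + ∫ t in (-ℓ)..x, v' t with hV
    have hVp : IsPrimitiveOn (-ℓ) ℓ V v' := ⟨hv'i, by simp [hV]⟩
    have key : ∀ x ∈ Ioc 0 ℓ, v x = V x →
        impedanceOp Kh v v' x = 1 / f x * schrodingerOp K v x := by
      intro x hx hvx
      obtain ⟨H, h1, h2, h3, h4⟩ := hH x hx
      have h5 := sub_integral_primitive_mul hx.1.le h1 h2 h3 h4
        (hVp.mono (c := -x) (d := x) ⟨by linarith [hx.2], by linarith [hx.1]⟩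
          ⟨by linarith [hx.1], hx.2⟩)
      have hxx : -x ≤ x := by linarith [hx.1]
      have h6 : ∫ t in (-x)..x, K x t * v t = ∫ t in (-x)..x, K x t * V t := by
        rw [← integral_Ioo_eq_intervalIntegral hxx, ← integral_Ioo_eq_intervalIntegral hxx]
        refine integral_congr_ae ((ae_restrict_iff' measurableSet_Ioo).2 ?_)
        filter_upwards [hc] with t ht htx
        rw [ht ⟨by linarith [hx.2, htx.1], by linarith [hx.2, htx.2]⟩]
      rw [impedanceOp, schrodingerOp, h6, hvx, h5]
    constructor
    · rw [ae_restrict_iff' measurableSet_Ioo]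
      filter_upwards [hc] with x hx hx0
      exact key x (Ioo_subset_Ioc_self hx0) (hx ⟨by linarith [hx0.1], hx0.2⟩)
    · intro hvc x hx
      rcases hx.1.eq_or_lt with h0 | h0
      -- At `x = 0` both integrals vanish and `f 0 = 1`.
      · subst h0
        simp [impedanceOp, schrodingerOp, hf_zero]
      · exact key x ⟨h0, hx.2⟩ (continuousOn_Icc_eqOn_of_ae hℓℓ hvc (hVp.continuousOn hℓℓ.le) hc
          ⟨by linarith, hx.2⟩)
  · have hfm : AEStronglyMeasurable (fun p : ℝ × ℝ => 1 / f p.1)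
        (volume.restrict (triangle ℓ)) := by
      refine ContinuousOn.aestronglyMeasurable ?_ (isClosed_triangle ℓ).measurableSet
      have h1 : ContinuousOn (fun x => 1 / f x) (Icc 0 ℓ) := continuousOn_const.div hfc hf_ne
      exact h1.comp continuous_fst.continuousOn fun p hp => ⟨hp.1, hp.2.1⟩
    have h0 := ae_triangle_eq_zero
      (D := fun p => dKh p.1 p.2 - 1 / f p.1 * K p.1 p.2)
      (hdm.sub (hfm.mul hK.1.1.aestronglyMeasurable)) fun x hx => by
        filter_upwards [(hd x hx).ae_unique (by linarith [hx.1]) (hprim x hx)] with t ht htx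
        exact sub_eq_zero.2 (ht htx)
    filter_upwards [h0] with p hp using sub_eq_zero.1 hp
  · obtain ⟨H, h1, h2, h3, h4⟩ := hH x hx
    exact ⟨H, ⟨h1.continuousOn (by linarith [hx.1]), (ae_restrict_iff' measurableSet_Ioo).2 h4⟩,
      h3, h2⟩
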